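/- Let $h>0$, let $A_0,A_1,D\in\mathbb R^{n\times n}$, and consider the neutral system $$\frac{\mathrm d}{\mathrm dt}\,[x(t)-Dx(t-h)]=A_0x(t)+A_1x(t-h),\qquad t\ge 0 .\tag{1}$$ For a piecewise continuously differentiable $\varphi:[-h,0]\to\mathbb R^n$, the solution $x(t,\varphi)$ is the piecewise continuous function with $x=\varphi$ on $[-h,0]$ such that $x(t)-Dx(t-h)$ is continuous for $t\ge 0$ and (1) holds except possibly at countably many points. System (1) is exponentially stable if there are $\gamma,\sigma>0$ with $\|x(t,\varphi)\|\le\gamma e^{-\sigma t}\sup_{\theta\in[-h,0]}\|\varphi(\theta)\|$ for all such $\varphi$ and all $t\ge0$. Let $W$ be a (symmetric) positive definite matrix and let $U:[-h,h]\to\mathbb R^{n\times n}$ be a delay Lyapunov matrix associated with $W$: $U$ is continuous, $U'(\theta)-U'(\theta-h)D=U(\theta)A_0+U(\theta-h)A_1$ for $\theta\in(0,h)$, $U^\top(\theta)=U(-\theta)$ for $\theta\in[-h,h]$, and $P-D^\top PD=-W$, where $P=\lim_{\theta\to0^+}(U'(\theta)-U'(-\theta))$. For $\xi\in\mathbb R^n$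 and $\varphi:[-h,0]\to\mathbb R^n$ put $$\begin{aligned}v(\xi,\varphi)=\;&\xi^\top U(0)\xi+2\xi^\top\!\int_{-h}^0\!\big(U^\top(h+\theta)A_1-U'^\top(h+\theta)D\big)\varphi(\theta)\,d\theta\\&+\int_{-h}^0\!\int_{-h}^0\!\varphi^\top(\theta_1)\big(A_1^\top U(\theta_1-\theta_2)A_1+2A_1^\top U'(\theta_1-\theta_2)D\big)\varphi(\theta_2)\,d\theta_2d\theta_1\\&-\int_{-h}^0\Big(\int_{-h}^{\theta_1}+\int_{\theta_1}^0\Big)\varphi^\top(\theta_1)D^\top U''(\theta_1-\theta_2)D\varphi(\theta_2)\,d\theta_2d\theta_1-\int_{-h}^0\varphi^\top(\theta)D^\top PD\varphi(\theta)\,d\theta,\end{aligned}$$ and $v_0(\varphi)=v(\varphi(0)-D\varphi(-h),\varphi)$. For $N\in\mathbb N$ let $\Theta_N^\top(\theta)=[I_n\ \ \theta I_n\ \cdots\ \theta^{N-1}I_n]$, and define the symmetric matrix $$\mathbf P_N=\begin{bmatrix}U(0)&J_1-J_2\\(J_1-J_2)^\top&J_3+J_4+J_4^\top-J_5-J_6\end{bmatrix}\in\mathbb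 R^{(n+nN)\times(n+nN)},$$ $$J_1=\int_{-h}^0U^\top(h+\theta)A_1\Theta_N^\top(\theta)\,d\theta,\quad J_2=\int_{-h}^0U'^\top(h+\theta)D\Theta_N^\top(\theta)\,d\theta,\quad J_6=\int_{-h}^0\Theta_N(\theta)D^\top PD\,\Theta_N^\top(\theta)\,d\theta,$$ $$J_3=\int_{-h}^0\!\int_{-h}^0\Theta_N(\theta_1)A_1^\top U(\theta_1-\theta_2)A_1\Theta_N^\top(\theta_2)\,d\theta_2d\theta_1,\quad J_4=\int_{-h}^0\!\int_{-h}^0\Theta_N(\theta_1)A_1^\top U'(\theta_1-\theta_2)D\,\Theta_N^\top(\theta_2)\,d\theta_2d\theta_1,$$ $$J_5=\int_{-h}^0\Big(\int_{-h}^{\theta_1}+\int_{\theta_1}^0\Big)\Theta_N(\theta_1)D^\top U''(\theta_1-\theta_2)D\,\Theta_N^\top(\theta_2)\,d\theta_2d\theta_1.$$ **Theorem.** If (1) is exponentially stable, then for every $N\in\mathbb N$ the matrix $\mathbf P_N$ is positive semidefinite. Moreover, $\mathbf P_N$, which is independent of the approximation, is the matrix of the quadratic form of every polynomial approximation of order $N$: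 let $p_0,\dots,p_{N-1}$ be real polynomials of degree less than $N$, $\mathcal Q=(\mathcal Q_0,\dots,\mathcal Q_{N-1})\in\mathbb R^{nN}$, $\varphi_N(\theta)=\sum_{j=0}^{N-1}p_j(\theta)\mathcal Q_j$, and let $\Phi_N\in\mathbb R^{nN}$ be the vector whose $k$-th block is $\sum_j [\theta^k]p_j\;\mathcal Q_j$. Then $\varphi_N(\theta)=\Theta_N^\top(\theta)\Phi_N$; with $\Xi=[(\varphi_N(0)-D\varphi_N(-h))^\top\ \ \Phi_N^\top]^\top$ one has $v_0(\varphi_N)=\Xi^\top\mathbf P_N\Xi$; and for every piecewise continuously differentiable $\varphi$ on $[-h,0]$, with $\Xi=[(\varphi(0)-D\varphi(-h))^\top\ \ \Phi_N^\top]^\top$, one has $v(\varphi(0)-D\varphi(-h),\varphi_N)=\Xi^\top\mathbf P_N\Xi$. -/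

import Mathlib

open Set Filter Topology Matrix MeasureTheory

namespace NeutralDelay

noncomputable section

/-- Piecewise continuous on `[a, b]`: continuous off finitely many points, with finite one-sided
limits everywhere (values at the finitely many exceptional points are arbitrary). -/
def IsPCOn {n : ℕ} (f : ℝ → Fin n → ℝ) (a b : ℝ) : Prop :=
  (∃ S : Finset ℝ, ∀ t ∈ Ioo a b, t ∉ S → ContinuousAt f t) ∧
  (∀ t ∈ Ico a b, ∃ l, Tendsto f (𝓝[>] t) (𝓝 l)) ∧
  (∀ t ∈ Ioc a b, ∃ l, Tendsto f (𝓝[<] t) (𝓝 l))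

/-- Piecewise continuously differentiable on `[a, b]`: `C¹` off finitely many points, where the
function and its derivative have finite one-sided limits everywhere. -/
def IsPC1On {n : ℕ} (f : ℝ → Fin n → ℝ) (a b : ℝ) : Prop :=
  (∃ S : Finset ℝ, ∀ t ∈ Ioo a b, t ∉ S → ContDiffAt ℝ 1 f t) ∧
  (∀ t ∈ Ico a b, (∃ l, Tendsto f (𝓝[>] t) (𝓝 l)) ∧ ∃ l, Tendsto (deriv f) (𝓝[>] t) (𝓝 l)) ∧
  (∀ t ∈ Ioc a b, (∃ l, Tendsto f (𝓝[<] t) (𝓝 l)) ∧ ∃ l, Tendsto (deriv f) (𝓝[<] t) (𝓝 l))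

/-- The Euclidean norm of a vector. -/
def eucl {n : ℕ} (v : Fin n → ℝ) : ℝ := ‖WithLp.toLp 2 v‖

/-- The uniform norm `sup_{θ ∈ [-h, 0]} ‖φ(θ)‖`. -/
def supNorm {n : ℕ} (h : ℝ) (φ : ℝ → Fin n → ℝ) : ℝ :=
  sSup ((fun θ => eucl (φ θ)) '' Icc (-h) 0)

/-- `x` is a solution, with initial function `φ` on `[-h, 0]`, of
`d/dt [x(t) - D x(t - h)] = A₀ x(t) + A₁ x(t - h)`: it is piecewise continuous, the difference
`x(t) - D x(t - h)` is continuous for `t ≥ 0`, and the equation holds for all `t > 0` except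
possibly a countable set of points. -/
structure IsSolution {n : ℕ} (h : ℝ) (A₀ A₁ D : Matrix (Fin n) (Fin n) ℝ)
    (φ x : ℝ → Fin n → ℝ) : Prop where
  initial : ∀ θ ∈ Icc (-h) 0, x θ = φ θ
  piecewise : ∀ T : ℝ, 0 < T → IsPCOn x (-h) T
  continuous_diff : ContinuousOn (fun t => x t - D *ᵥ x (t - h)) (Ici 0)
  equation : ∃ S : Set ℝ, S.Countable ∧ ∀ t : ℝ, 0 < t → t ∉ S →
    HasDerivAt (fun s => x s - D *ᵥ x (s - h)) (A₀ *ᵥ x t + A₁ *ᵥ x (t - h)) t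

/-- Exponential stability of the neutral system. -/
def ExpStable {n : ℕ} (h : ℝ) (A₀ A₁ D : Matrix (Fin n) (Fin n) ℝ) : Prop :=
  ∃ γ > 0, ∃ σ > 0, ∀ φ : ℝ → Fin n → ℝ, IsPC1On φ (-h) 0 →
    ∀ x : ℝ → Fin n → ℝ, IsSolution h A₀ A₁ D φ x →
      ∀ t : ℝ, 0 ≤ t → eucl (x t) ≤ γ * Real.exp (-σ * t) * supNorm h φ

/-- Entrywise derivative of a matrix function. -/
def mderiv {n : ℕ} (U : ℝ → Matrix (Fin n) (Fin n) ℝ) (θ : ℝ) : Matrix (Fin n) (Fin n) ℝ :=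
  Matrix.of fun i j => deriv (fun s => U s i j) θ

/-- `U` is a delay Lyapunov matrix on `[-h, h]` associated with `W`, and
`P = lim_{θ → 0+} (U'(θ) - U'(-θ))` is the jump of its derivative at `0`. -/
structure IsDelayLyapunovMatrix {n : ℕ} (h : ℝ) (A₀ A₁ D W : Matrix (Fin n) (Fin n) ℝ)
    (U : ℝ → Matrix (Fin n) (Fin n) ℝ) (P : Matrix (Fin n) (Fin n) ℝ) : Prop where
  continuousOn : ContinuousOn U (Icc (-h) h)
  differentiable : ∀ θ ∈ Ioo 0 h, ∀ i j, DifferentiableAt ℝ (fun s => U s i j) θ ∧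
    DifferentiableAt ℝ (fun s => U s i j) (θ - h)
  dynamic : ∀ θ ∈ Ioo 0 h,
    mderiv U θ - mderiv U (θ - h) * D = U θ * A₀ + U (θ - h) * A₁
  symmetry : ∀ θ ∈ Icc (-h) h, (U θ)ᵀ = U (-θ)
  jump : Tendsto (fun θ => mderiv U θ - mderiv U (-θ)) (𝓝[>] 0) (𝓝 P)
  algebraic : P - Dᵀ * P * D = -W

/-- The Lyapunov-Krasovskii functional, as a function of the vector `ξ`, which stands for
`φ(0) - D φ(-h)`, and of the function `φ` under the integrals. -/
def functional {n : ℕ} (h : ℝ) (A₁ D : Matrix (Fin n) (Fin n) ℝ)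
    (U : ℝ → Matrix (Fin n) (Fin n) ℝ) (P : Matrix (Fin n) (Fin n) ℝ)
    (ξ : Fin n → ℝ) (φ : ℝ → Fin n → ℝ) : ℝ :=
  ξ ⬝ᵥ U 0 *ᵥ ξ
  + 2 * (ξ ⬝ᵥ ∫ θ in (-h)..0, ((U (h + θ))ᵀ * A₁) *ᵥ φ θ)
  - 2 * (ξ ⬝ᵥ ∫ θ in (-h)..0, ((mderiv U (h + θ))ᵀ * D) *ᵥ φ θ)
  + (∫ θ₁ in (-h)..0, ∫ θ₂ in (-h)..0, φ θ₁ ⬝ᵥ (A₁ᵀ * U (θ₁ - θ₂) * A₁) *ᵥ φ θ₂)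
  + 2 * (∫ θ₁ in (-h)..0, ∫ θ₂ in (-h)..0,
      φ θ₁ ⬝ᵥ (A₁ᵀ * mderiv U (θ₁ - θ₂) * D) *ᵥ φ θ₂)
  + (-(∫ θ₁ in (-h)..0, ∫ θ₂ in (-h)..θ₁,
        φ θ₁ ⬝ᵥ (Dᵀ * mderiv (mderiv U) (θ₁ - θ₂) * D) *ᵥ φ θ₂)
      - ∫ θ₁ in (-h)..0, ∫ θ₂ in θ₁..0,
        φ θ₁ ⬝ᵥ (Dᵀ * mderiv (mderiv U) (θ₁ - θ₂) * D) *ᵥ φ θ₂)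
  - ∫ θ in (-h)..0, φ θ ⬝ᵥ (Dᵀ * P * D) *ᵥ φ θ

/-- The functional `v₀(φ)`. -/
def v0 {n : ℕ} (h : ℝ) (A₁ D : Matrix (Fin n) (Fin n) ℝ)
    (U : ℝ → Matrix (Fin n) (Fin n) ℝ) (P : Matrix (Fin n) (Fin n) ℝ)
    (φ : ℝ → Fin n → ℝ) : ℝ :=
  functional h A₁ D U P (φ 0 - D *ᵥ φ (-h)) φ

/-- `Θ_N(θ)ᵀ = [I, θ I, …, θ^{N-1} I]`; column `(k, j)` is the `j`-th column of block `k`. -/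
def thetaT (n N : ℕ) (θ : ℝ) : Matrix (Fin n) (Fin N × Fin n) ℝ :=
  Matrix.of fun i p => θ ^ (p.1 : ℕ) * (1 : Matrix (Fin n) (Fin n) ℝ) i p.2

/-- `Θ_N(θ)`. -/
def theta (n N : ℕ) (θ : ℝ) : Matrix (Fin N × Fin n) (Fin n) ℝ := (thetaT n N θ)ᵀ

/-- `P_N(θ)ᵀ = [p₀(θ) I, …, p_{N-1}(θ) I]` for polynomials `p₀, …, p_{N-1}`. -/
def polyT {n N : ℕ} (p : Fin N → Polynomial ℝ) (θ : ℝ) : Matrix (Fin n) (Fin N × Fin n) ℝ :=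
  Matrix.of fun i q => (p q.1).eval θ * (1 : Matrix (Fin n) (Fin n) ℝ) i q.2

/-- The polynomial approximation `φ_N(θ) = P_N(θ)ᵀ Q`. -/
def polyApprox {n N : ℕ} (p : Fin N → Polynomial ℝ) (Q : Fin N × Fin n → ℝ)
    (θ : ℝ) : Fin n → ℝ :=
  polyT p θ *ᵥ Q

/-- The monomial coefficients `Φ_N` of `φ_N`, obtained by expanding the polynomials `p_j`. -/
def monomialCoeffs {n N : ℕ} (p : Fin N → Polynomial ℝ) (Q : Fin N × Fin n → ℝ) :
    Fin N × Fin n → ℝ :=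
  fun q => ∑ j : Fin N, (p j).coeff (q.1 : ℕ) * Q (j, q.2)

/-- The vector `Ξ = [ξᵀ, Φᵀ]ᵀ`. -/
def Xi {n N : ℕ} (ξ : Fin n → ℝ) (Φ : Fin N × Fin n → ℝ) : Fin n ⊕ Fin N × Fin n → ℝ :=
  Sum.elim ξ Φ

/-- `J₁ = ∫ U(h+θ)ᵀ A₁ Θ_N(θ)ᵀ dθ`; matrix integrals are entrywise. -/
def J1 {n : ℕ} (N : ℕ) (h : ℝ) (A₁ : Matrix (Fin n) (Fin n) ℝ)
    (U : ℝ → Matrix (Fin n) (Fin n) ℝ) : Matrix (Fin n) (Fin N × Fin n) ℝ :=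
  Matrix.of fun i q => ∫ θ in (-h)..0, ((U (h + θ))ᵀ * A₁ * thetaT n N θ) i q

/-- `J₂ = ∫ U'(h+θ)ᵀ D Θ_N(θ)ᵀ dθ`. -/
def J2 {n : ℕ} (N : ℕ) (h : ℝ) (D : Matrix (Fin n) (Fin n) ℝ)
    (U : ℝ → Matrix (Fin n) (Fin n) ℝ) : Matrix (Fin n) (Fin N × Fin n) ℝ :=
  Matrix.of fun i q => ∫ θ in (-h)..0, ((mderiv U (h + θ))ᵀ * D * thetaT n N θ) i q

/-- `J₃ = ∫∫ Θ_N(θ₁) A₁ᵀ U(θ₁-θ₂) A₁ Θ_N(θ₂)ᵀ dθ₂ dθ₁`. -/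
def J3 {n : ℕ} (N : ℕ) (h : ℝ) (A₁ : Matrix (Fin n) (Fin n) ℝ)
    (U : ℝ → Matrix (Fin n) (Fin n) ℝ) : Matrix (Fin N × Fin n) (Fin N × Fin n) ℝ :=
  Matrix.of fun q r => ∫ θ₁ in (-h)..0, ∫ θ₂ in (-h)..0,
    (theta n N θ₁ * (A₁ᵀ * U (θ₁ - θ₂) * A₁) * thetaT n N θ₂) q r

/-- `J₄ = ∫∫ Θ_N(θ₁) A₁ᵀ U'(θ₁-θ₂) D Θ_N(θ₂)ᵀ dθ₂ dθ₁`. -/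
def J4 {n : ℕ} (N : ℕ) (h : ℝ) (A₁ D : Matrix (Fin n) (Fin n) ℝ)
    (U : ℝ → Matrix (Fin n) (Fin n) ℝ) : Matrix (Fin N × Fin n) (Fin N × Fin n) ℝ :=
  Matrix.of fun q r => ∫ θ₁ in (-h)..0, ∫ θ₂ in (-h)..0,
    (theta n N θ₁ * (A₁ᵀ * mderiv U (θ₁ - θ₂) * D) * thetaT n N θ₂) q r

/-- `J₅ = ∫ (∫_{θ₂<θ₁} + ∫_{θ₂>θ₁}) Θ_N(θ₁) Dᵀ U''(θ₁-θ₂) D Θ_N(θ₂)ᵀ dθ₂ dθ₁`. -/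
def J5 {n : ℕ} (N : ℕ) (h : ℝ) (D : Matrix (Fin n) (Fin n) ℝ)
    (U : ℝ → Matrix (Fin n) (Fin n) ℝ) : Matrix (Fin N × Fin n) (Fin N × Fin n) ℝ :=
  Matrix.of fun q r => ∫ θ₁ in (-h)..0,
    ((∫ θ₂ in (-h)..θ₁,
        (theta n N θ₁ * (Dᵀ * mderiv (mderiv U) (θ₁ - θ₂) * D) * thetaT n N θ₂) q r)
      + ∫ θ₂ in θ₁..0,
        (theta n N θ₁ * (Dᵀ * mderiv (mderiv U) (θ₁ - θ₂) * D) * thetaT n N θ₂) q r)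

/-- `J₆ = ∫ Θ_N(θ) Dᵀ P D Θ_N(θ)ᵀ dθ`. -/
def J6 {n : ℕ} (N : ℕ) (h : ℝ) (D P : Matrix (Fin n) (Fin n) ℝ) :
    Matrix (Fin N × Fin n) (Fin N × Fin n) ℝ :=
  Matrix.of fun q r => ∫ θ in (-h)..0, (theta n N θ * (Dᵀ * P * D) * thetaT n N θ) q r

/-- The symmetric matrix `𝐏_N` of the quadratic form obtained from the functional. The matrix `J₄`
is not symmetric in general, so its contribution to the symmetric matrix is `J₄ + J₄ᵀ`. -/
def PMat {n : ℕ} (N : ℕ) (h : ℝ) (A₁ D : Matrix (Fin n) (Fin n) ℝ)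
    (U : ℝ → Matrix (Fin n) (Fin n) ℝ) (P : Matrix (Fin n) (Fin n) ℝ) :
    Matrix (Fin n ⊕ Fin N × Fin n) (Fin n ⊕ Fin N × Fin n) ℝ :=
  Matrix.fromBlocks (U 0) (J1 N h A₁ U - J2 N h D U) (J1 N h A₁ U - J2 N h D U)ᵀ
    (J3 N h A₁ U + (J4 N h A₁ D U + (J4 N h A₁ D U)ᵀ) - J5 N h D U - J6 N h D P)

end

end NeutralDelay

/-!
Evaluated on polynomials of degree less than `N`, the functional `v` is by bilinearity the quadratic
form of `𝐏_N`, so it suffices to show `v(ξ, φ) ≥ 0` for smooth `φ` and arbitrary `ξ`.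

Stability of the neutral system forces `D ^ k → 0`: the response to `sin(ω s) w` is, in the limit
`ω → ∞`, that of the difference equation `x(t) = D x(t - h)` alone. Hence the Stein map
`X ↦ X - Dᵀ X D` is injective, and the dynamic equation of `U` at `θ` and at `h - θ` can be solved
for `U'(θ)` as a linear function of `U(θ)` and `U(h - θ)`. So `U` is twice continuously
differentiable on `[0, h]`, and the functional has kernels which are continuous off the diagonal.

Along a solution with a `C¹` initial function, the functional then decreases at the rate `xᵀ W x`,
and it tends to `0` by stability, so it is nonnegative at `ξ = φ(0) - D φ(-h)`. An arbitrary `ξ` is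
reached through the initial functions `φ + (1 + θ / h) ^ (m + 1) a`, which tend to `φ` boundedly as
`m → ∞` and have a prescribed value of `φ(0) - D φ(-h)`.
-/

namespace NeutralDelay

noncomputable section

/-! ## Integrals with parameters -/

section ParametricIntegrals

variable {E : Type*} [NormedAddCommGroup E]

theorem intervalIntegrable_uncurry_left {k : ℝ → ℝ → E} (hk : Continuous (Function.uncurry k))
    (s a b : ℝ) : IntervalIntegrable (k s) volume a b :=
  (hk.uncurry_left s).intervalIntegrable a b

/-- The kernel `g` coincides with `k₁` below and with `k₂` above the diagonal of the open square
`(a, c)²`. Nothing is required of `g` on the diagonal, where the kernels of the functional involve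
derivatives which do not exist. -/
structure IsSplitKernel (a c : ℝ) (g k₁ k₂ : ℝ → ℝ → E) : Prop where
  eqOn_lower : ∀ s ∈ Ioo a c, EqOn (g s) (k₁ s) (Ioo a s)
  eqOn_upper : ∀ s ∈ Ioo a c, EqOn (g s) (k₂ s) (Ioo s c)
  continuous_lower : Continuous (Function.uncurry k₁)
  continuous_upper : Continuous (Function.uncurry k₂)

theorem IsSplitKernel.comp_sub {M : Type*} [TopologicalSpace M] {h : ℝ} {K L₁ L₂ : ℝ → M}
    {F : ℝ → ℝ → M → E}
    (hpos : ∀ r ∈ Ioo 0 h, K r = L₁ r) (hneg : ∀ r ∈ Ioo 0 h, K (-r) = L₂ r)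
    (h₁ : Continuous L₁) (h₂ : Continuous L₂)
    (hF : Continuous fun p : ℝ × ℝ × M => F p.1 p.2.1 p.2.2) :
    IsSplitKernel (-h) 0 (fun s r => F s r (K (s - r))) (fun s r => F s r (L₁ (s - r)))
      (fun s r => F s r (L₂ (r - s))) where
  eqOn_lower s hs r hr := by
    simp only [hpos (s - r) ⟨sub_pos.2 hr.2, by linarith [hs.2, hr.1]⟩]
  eqOn_upper s hs r hr := by
    simp only [← neg_sub r s, hneg (r - s) ⟨sub_pos.2 hr.1, by linarith [hs.1, hr.2]⟩]
  continuous_lower := hF.comp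
    (f := fun p : ℝ × ℝ => (p.1, p.2, L₁ (p.1 - p.2))) (by fun_prop)
  continuous_upper := hF.comp
    (f := fun p : ℝ × ℝ => (p.1, p.2, L₂ (p.2 - p.1))) (by fun_prop)

variable [NormedSpace ℝ E]

theorem hasDerivAt_integral_right [CompleteSpace E] {f : ℝ → E} (hf : Continuous f) (a b : ℝ) :
    HasDerivAt (fun u => ∫ s in a..u, f s) (f b) b :=
  (hf.integral_hasStrictDerivAt a b).hasDerivAt

theorem hasDerivAt_integral_left [CompleteSpace E] {f : ℝ → E} (hf : Continuous f) (a b : ℝ) :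
    HasDerivAt (fun u => ∫ s in u..b, f s) (-f a) a :=
  intervalIntegral.integral_hasDerivAt_left (hf.intervalIntegrable _ _)
    (hf.stronglyMeasurableAtFilter _ _) hf.continuousAt

theorem continuous_integral_limits {X : Type*} [TopologicalSpace X] {k : ℝ → ℝ → E}
    (hk : Continuous (Function.uncurry k)) {u v w : X → ℝ} (hu : Continuous u) (hv : Continuous v)
    (hw : Continuous w) : Continuous fun x => ∫ r in u x..v x, k (w x) r := by
  have hint := intervalIntegrable_uncurry_left hk
  have hprim : Continuous fun p : ℝ × ℝ => ∫ r in (0 : ℝ)..p.2, k p.1 r :=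
    intervalIntegral.continuous_parametric_primitive_of_continuous hk
  refine ((hprim.comp (hw.prodMk hv)).sub (hprim.comp (hw.prodMk hu))).congr fun x => ?_
  exact intervalIntegral.integral_interval_sub_left (hint _ _ _) (hint _ _ _)

theorem intervalIntegrable_integral_lower {k : ℝ → ℝ → E}
    (hk : Continuous (Function.uncurry k)) (a c : ℝ) :
    IntervalIntegrable (fun s => ∫ r in a..s, k s r) volume a c :=
  (continuous_integral_limits hk continuous_const continuous_id
    continuous_id).intervalIntegrable _ _

theorem intervalIntegrable_integral_upper {k : ℝ → ℝ → E}
    (hk : Continuous (Function.uncurry k)) (a c : ℝ) :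
    IntervalIntegrable (fun s => ∫ r in s..c, k s r) volume a c :=
  (continuous_integral_limits hk continuous_id continuous_const
    continuous_id).intervalIntegrable _ _

theorem hasDerivAt_integral_of_continuous_deriv {f f' : ℝ → ℝ → E}
    (hf : Continuous (Function.uncurry f)) (hf' : Continuous (Function.uncurry f'))
    (hd : ∀ t s, HasDerivAt (fun t => f t s) (f' t s) t) (a b t : ℝ) :
    HasDerivAt (fun t => ∫ s in a..b, f t s) (∫ s in a..b, f' t s) t := by
  have hcompact : IsCompact (Icc (t - 1) (t + 1) ×ˢ uIcc a b) := isCompact_Icc.prod isCompact_uIcc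
  obtain ⟨C, hC⟩ := hcompact.exists_bound_of_continuousOn hf'.continuousOn
  refine (intervalIntegral.hasDerivAt_integral_of_dominated_loc_of_deriv_le
    (F := f) (F' := f') (s := Icc (t - 1) (t + 1)) (bound := fun _ => C)
    (Icc_mem_nhds (by linarith) (by linarith))
    (Eventually.of_forall fun x => (hf.uncurry_left x).aestronglyMeasurable)
    (intervalIntegrable_uncurry_left hf t a b)
    (hf'.uncurry_left t).aestronglyMeasurable
    (Eventually.of_forall fun s hs x hx => hC (x, s) ⟨hx, uIoc_subset_uIcc hs⟩)
    intervalIntegrable_const (Eventually.of_forall fun s _ x _ => hd x s)).2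

theorem hasDerivAt_integral_param_right [CompleteSpace E] {f f' : ℝ → ℝ → E}
    (hf : Continuous (Function.uncurry f)) (hf' : Continuous (Function.uncurry f'))
    (hd : ∀ t s, HasDerivAt (fun t => f t s) (f' t s) t) (a : ℝ) {b : ℝ → ℝ} {b' t : ℝ}
    (hb : HasDerivAt b b' t) :
    HasDerivAt (fun t => ∫ s in a..b t, f t s) (b' • f t (b t) + ∫ s in a..b t, f' t s) t := by
  have hspan := (ContinuousLinearMap.toSpanSingletonCLE (𝕜 := ℝ) (E := E)).continuous
  have hprim : Continuous fun v : ℝ × ℝ => ∫ s in a..v.2, f' v.1 s :=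
    intervalIntegral.continuous_parametric_primitive_of_continuous hf'
  have hjoint := hasStrictFDerivAt_uncurry_coprod (𝕜 := ℝ) (u := (t, b t))
    (f := fun q p => ∫ s in a..p, f q s)
    (f₁ := fun q p => ContinuousLinearMap.toSpanSingleton ℝ (∫ s in a..p, f' q s))
    (f₂ := fun q p => ContinuousLinearMap.toSpanSingleton ℝ (f q p))
    (Eventually.of_forall fun v =>
      (hasDerivAt_integral_of_continuous_deriv hf hf' hd a v.2 v.1).hasFDerivAt)
    (Eventually.of_forall fun v =>
      (hasDerivAt_integral_right (hf.uncurry_left v.1) a v.2).hasFDerivAt)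
    (hspan.comp hprim).continuousAt (hspan.comp hf).continuousAt
  refine (hjoint.hasFDerivAt.comp_hasDerivAt t ((hasDerivAt_id t).prodMk hb)).congr_deriv ?_
  simp [Function.HasUncurry.uncurry, add_comm]

theorem hasDerivAt_integral_param [CompleteSpace E] {f f' : ℝ → ℝ → E}
    (hf : Continuous (Function.uncurry f)) (hf' : Continuous (Function.uncurry f'))
    (hd : ∀ t s, HasDerivAt (fun t => f t s) (f' t s) t) {a b : ℝ → ℝ} {a' b' t : ℝ}
    (ha : HasDerivAt a a' t) (hb : HasDerivAt b b' t) :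
    HasDerivAt (fun t => ∫ s in a t..b t, f t s)
      (b' • f t (b t) - a' • f t (a t) + ∫ s in a t..b t, f' t s) t := by
  have hsplit : ∀ {g : ℝ → ℝ → E}, Continuous (Function.uncurry g) → ∀ t,
      ∫ s in a t..b t, g t s = (∫ s in (0 : ℝ)..b t, g t s) - ∫ s in (0 : ℝ)..a t, g t s :=
    fun hg t => (intervalIntegral.integral_interval_sub_left
      (intervalIntegrable_uncurry_left hg _ _ _) (intervalIntegrable_uncurry_left hg _ _ _)).symm
  rw [hsplit hf', funext (hsplit hf)]
  refine ((hasDerivAt_integral_param_right hf hf' hd 0 hb).sub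
    (hasDerivAt_integral_param_right hf hf' hd 0 ha)).congr_deriv ?_
  abel

theorem integral_triangle_swap [CompleteSpace E] {k : ℝ → ℝ → E}
    (hk : Continuous (Function.uncurry k)) (a c : ℝ) :
    ∫ s in a..c, ∫ r in a..s, k s r = ∫ s in a..c, ∫ r in s..c, k r s := by
  have hk' : Continuous (Function.uncurry fun s r => k r s) := hk.comp continuous_swap
  have hleft : ∀ c, HasDerivAt (fun c => ∫ s in a..c, ∫ r in a..s, k s r)
      (∫ r in a..c, k c r) c := fun c =>
    hasDerivAt_integral_right
      (continuous_integral_limits hk continuous_const continuous_id continuous_id) a c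
  have hright : ∀ c, HasDerivAt (fun c => ∫ s in a..c, ∫ r in s..c, k r s)
      (∫ r in a..c, k c r) c := fun c => by
    refine (hasDerivAt_integral_param_right (f := fun c s => ∫ r in s..c, k r s)
      (continuous_integral_limits hk' continuous_snd continuous_fst continuous_snd) hk
      (fun c s => hasDerivAt_integral_right (hk'.uncurry_left s) s c) a
      (hasDerivAt_id c)).congr_deriv ?_
    simp
  have hconst := is_const_of_deriv_eq_zero (f := fun c =>
      (∫ s in a..c, ∫ r in a..s, k s r) - ∫ s in a..c, ∫ r in s..c, k r s)
    (fun c => ((hleft c).sub (hright c)).differentiableAt)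
    (fun c => (((hleft c).sub (hright c)).congr_deriv (sub_self _)).deriv) c a
  simpa [sub_eq_zero] using hconst

/-- The double integral over the square `[a, c]²` of the kernel which is `k₁` below and `k₂` above
the diagonal. The two triangles are kept apart because the second derivative of a delay Lyapunov
matrix is not defined at `0`, so that the kernels of the functional jump there. -/
def triInt (a c : ℝ) (k₁ k₂ : ℝ → ℝ → E) : E :=
  ∫ s in a..c, ((∫ r in a..s, k₁ s r) + ∫ r in s..c, k₂ s r)

theorem triInt_eq_add {k₁ k₂ : ℝ → ℝ → E} (h₁ : Continuous (Function.uncurry k₁))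
    (h₂ : Continuous (Function.uncurry k₂)) (a c : ℝ) :
    triInt a c k₁ k₂ = (∫ s in a..c, ∫ r in a..s, k₁ s r) + ∫ s in a..c, ∫ r in s..c, k₂ s r :=
  intervalIntegral.integral_add (intervalIntegrable_integral_lower h₁ a c)
    (intervalIntegrable_integral_upper h₂ a c)

theorem triInt_congr {a c : ℝ} (hac : a ≤ c) {k₁ k₂ l₁ l₂ : ℝ → ℝ → E}
    (h₁ : ∀ s ∈ Ioo a c, EqOn (k₁ s) (l₁ s) (Ioo a s))
    (h₂ : ∀ s ∈ Ioo a c, EqOn (k₂ s) (l₂ s) (Ioo s c)) : triInt a c k₁ k₂ = triInt a c l₁ l₂ :=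
  intervalIntegral.integral_congr_Ioo_of_le hac fun s hs =>
    congrArg₂ (· + ·) (intervalIntegral.integral_congr_Ioo_of_le hs.1.le (h₁ s hs))
      (intervalIntegral.integral_congr_Ioo_of_le hs.2.le (h₂ s hs))

theorem hasDerivAt_triInt [CompleteSpace E] {k₁ k₂ : ℝ → ℝ → E}
    (h₁ : Continuous (Function.uncurry k₁)) (h₂ : Continuous (Function.uncurry k₂)) (h t : ℝ) :
    HasDerivAt (fun t => triInt (t - h) t k₁ k₂)
      ((∫ r in (t - h)..t, k₁ t r) - (∫ r in (t - h)..t, k₂ (t - h) r)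
        + ∫ s in (t - h)..t, (k₂ s t - k₁ s (t - h))) t := by
  have hinner : Continuous (Function.uncurry fun t s : ℝ =>
      (∫ r in (t - h)..s, k₁ s r) + ∫ r in s..t, k₂ s r) :=
    (continuous_integral_limits h₁ (continuous_fst.sub continuous_const) continuous_snd
      continuous_snd).add
      (continuous_integral_limits h₂ continuous_snd continuous_fst continuous_snd)
  have hinner' : Continuous (Function.uncurry fun t s : ℝ => k₂ s t - k₁ s (t - h)) :=
    (h₂.comp continuous_swap).sub
      (h₁.comp (continuous_snd.prodMk (continuous_fst.sub continuous_const)))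
  have hd : ∀ t s, HasDerivAt (fun t => (∫ r in (t - h)..s, k₁ s r) + ∫ r in s..t, k₂ s r)
      (k₂ s t - k₁ s (t - h)) t := fun t s => by
    refine (((hasDerivAt_integral_left (h₁.uncurry_left s) _ s).comp_sub_const t h).add
      (hasDerivAt_integral_right (h₂.uncurry_left s) s t)).congr_deriv ?_
    abel
  refine (hasDerivAt_integral_param hinner hinner' hd ((hasDerivAt_id t).sub_const h)
    (hasDerivAt_id t)).congr_deriv ?_
  simp

theorem triInt_swap [CompleteSpace E] {k₁ k₂ : ℝ → ℝ → E} (h₁ : Continuous (Function.uncurry k₁))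
    (h₂ : Continuous (Function.uncurry k₂)) (a c : ℝ) :
    triInt a c k₁ k₂ = triInt a c (fun s r => k₂ r s) (fun s r => k₁ r s) := by
  have h₁' : Continuous (Function.uncurry fun s r => k₁ r s) := h₁.comp continuous_swap
  have h₂' : Continuous (Function.uncurry fun s r => k₂ r s) := h₂.comp continuous_swap
  rw [triInt_eq_add h₁ h₂, triInt_eq_add h₂' h₁', integral_triangle_swap h₁,
    integral_triangle_swap h₂', add_comm]

theorem triInt_comp_add (a c t : ℝ) (k₁ k₂ : ℝ → ℝ → E) :
    triInt a c (fun s r => k₁ (s + t) (r + t)) (fun s r => k₂ (s + t) (r + t)) =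
      triInt (a + t) (c + t) k₁ k₂ := by
  have hinner : ∀ s, (∫ r in a..s, k₁ (s + t) (r + t)) + (∫ r in s..c, k₂ (s + t) (r + t)) =
      (∫ r in (a + t)..(s + t), k₁ (s + t) r) + ∫ r in (s + t)..(c + t), k₂ (s + t) r := fun s => by
    rw [intervalIntegral.integral_comp_add_right, intervalIntegral.integral_comp_add_right]
  unfold triInt
  simp only [hinner]
  exact intervalIntegral.integral_comp_add_right
    (fun s => (∫ r in (a + t)..s, k₁ s r) + ∫ r in s..(c + t), k₂ s r) t

theorem triInt_add {k₁ k₂ l₁ l₂ : ℝ → ℝ → E} (hk₁ : Continuous (Function.uncurry k₁))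
    (hk₂ : Continuous (Function.uncurry k₂)) (hl₁ : Continuous (Function.uncurry l₁))
    (hl₂ : Continuous (Function.uncurry l₂)) (a c : ℝ) :
    triInt a c (fun s r => k₁ s r + l₁ s r) (fun s r => k₂ s r + l₂ s r) =
      triInt a c k₁ k₂ + triInt a c l₁ l₂ := by
  have hint := fun {k : ℝ → ℝ → E} (hk : Continuous (Function.uncurry k)) =>
    intervalIntegrable_uncurry_left hk
  unfold triInt
  rw [← intervalIntegral.integral_add
    ((intervalIntegrable_integral_lower hk₁ _ _).add (intervalIntegrable_integral_upper hk₂ _ _))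
    ((intervalIntegrable_integral_lower hl₁ _ _).add (intervalIntegrable_integral_upper hl₂ _ _))]
  refine intervalIntegral.integral_congr fun s _ => ?_
  simp only
  rw [intervalIntegral.integral_add (hint hk₁ _ _ _) (hint hl₁ _ _ _),
    intervalIntegral.integral_add (hint hk₂ _ _ _) (hint hl₂ _ _ _)]
  abel

theorem triInt_smul (r a c : ℝ) (k₁ k₂ : ℝ → ℝ → E) :
    triInt a c (fun s t => r • k₁ s t) (fun s t => r • k₂ s t) = r • triInt a c k₁ k₂ := by
  simp only [triInt, intervalIntegral.integral_smul, ← smul_add]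

theorem triInt_sub {k₁ k₂ l₁ l₂ : ℝ → ℝ → E} (hk₁ : Continuous (Function.uncurry k₁))
    (hk₂ : Continuous (Function.uncurry k₂)) (hl₁ : Continuous (Function.uncurry l₁))
    (hl₂ : Continuous (Function.uncurry l₂)) (a c : ℝ) :
    triInt a c (fun s r => k₁ s r - l₁ s r) (fun s r => k₂ s r - l₂ s r) =
      triInt a c k₁ k₂ - triInt a c l₁ l₂ := by
  have hneg := triInt_smul (-1) a c l₁ l₂
  simp only [neg_one_smul] at hneg
  simp only [sub_eq_add_neg]
  rw [← hneg]
  exact triInt_add (l₁ := fun s r => -l₁ s r) (l₂ := fun s r => -l₂ s r) hk₁ hk₂ hl₁.neg hl₂.neg a c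

theorem map_triInt {F : Type*} [NormedAddCommGroup F] [NormedSpace ℝ F] [CompleteSpace E]
    [CompleteSpace F] (L : E →L[ℝ] F) {k₁ k₂ : ℝ → ℝ → E}
    (h₁ : Continuous (Function.uncurry k₁)) (h₂ : Continuous (Function.uncurry k₂)) (a c : ℝ) :
    L (triInt a c k₁ k₂) = triInt a c (fun s r => L (k₁ s r)) (fun s r => L (k₂ s r)) := by
  unfold triInt
  rw [← L.intervalIntegral_comp_comm
    ((intervalIntegrable_integral_lower h₁ a c).add (intervalIntegrable_integral_upper h₂ a c))]
  refine intervalIntegral.integral_congr fun s _ => ?_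
  simp only [map_add]
  rw [← L.intervalIntegral_comp_comm (intervalIntegrable_uncurry_left h₁ s _ _),
    ← L.intervalIntegral_comp_comm (intervalIntegrable_uncurry_left h₂ s _ _)]

namespace IsSplitKernel

variable {a c : ℝ} {g k₁ k₂ : ℝ → ℝ → E}

theorem triInt_self (hg : IsSplitKernel a c g k₁ k₂) (hac : a ≤ c) :
    triInt a c g g = triInt a c k₁ k₂ :=
  triInt_congr hac hg.eqOn_lower hg.eqOn_upper

theorem integral_square (hg : IsSplitKernel a c g k₁ k₂) (hac : a ≤ c) :
    ∫ s in a..c, ∫ r in a..c, g s r = triInt a c k₁ k₂ := by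
  rw [← hg.triInt_self hac]
  refine intervalIntegral.integral_congr_Ioo_of_le hac fun s hs =>
    (intervalIntegral.integral_add_adjacent_intervals ?_ ?_).symm
  · refine (intervalIntegrable_uncurry_left hg.continuous_lower s _ _).congr_uIoo ?_
    rw [uIoo_of_le hs.1.le]
    exact (hg.eqOn_lower s hs).symm
  · refine (intervalIntegrable_uncurry_left hg.continuous_upper s _ _).congr_uIoo ?_
    rw [uIoo_of_le hs.2.le]
    exact (hg.eqOn_upper s hs).symm

theorem integral_triangles (hg : IsSplitKernel a c g k₁ k₂) (hac : a ≤ c) :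
    (∫ s in a..c, ∫ r in a..s, g s r) + ∫ s in a..c, ∫ r in s..c, g s r =
      triInt a c k₁ k₂ := by
  rw [triInt_eq_add hg.continuous_lower hg.continuous_upper]
  congr 1
  · exact intervalIntegral.integral_congr_Ioo_of_le hac fun s hs =>
      intervalIntegral.integral_congr_Ioo_of_le hs.1.le (hg.eqOn_lower s hs)
  · exact intervalIntegral.integral_congr_Ioo_of_le hac fun s hs =>
      intervalIntegral.integral_congr_Ioo_of_le hs.2.le (hg.eqOn_upper s hs)

end IsSplitKernel

end ParametricIntegrals

/-! ## Neutral equations with continuous solutions -/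

section VariationOfConstants

variable {E : Type*} [NormedAddCommGroup E] [NormedSpace ℝ E]

/-- The solution of `y' = a y + f`, `y 0 = y₀`, by variation of constants. -/
def linSol (a : E →L[ℝ] E) (y₀ : E) (f : ℝ → E) (t : ℝ) : E :=
  NormedSpace.exp (t • a) (y₀ + ∫ s in (0 : ℝ)..t, NormedSpace.exp (-(s • a)) (f s))

theorem linSol_zero (a : E →L[ℝ] E) (y₀ : E) (f : ℝ → E) : linSol a y₀ f 0 = y₀ := by
  simp [linSol]

theorem hasDerivAt_linSol [CompleteSpace E] (a : E →L[ℝ] E) (y₀ : E) {f : ℝ → E}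
    (hf : Continuous f) (t : ℝ) :
    HasDerivAt (linSol a y₀ f) (a (linSol a y₀ f t) + f t) t := by
  have hexp : ∀ t : ℝ, HasDerivAt (fun u : ℝ => NormedSpace.exp (u • a))
      (a * NormedSpace.exp (t • a)) t := fun t => hasDerivAt_exp_smul_const' a t
  have hexp_neg : Continuous fun u : ℝ => NormedSpace.exp (-(u • a)) := by
    have hcont : Continuous fun u : ℝ => NormedSpace.exp (u • a) :=
      continuous_iff_continuousAt.2 fun t => (hexp t).continuousAt
    simpa [Function.comp_def] using hcont.comp continuous_neg
  have hinv : NormedSpace.exp (t • a) * NormedSpace.exp (-(t • a)) = 1 := by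
    let : NormedAlgebra ℚ (E →L[ℝ] E) := NormedAlgebra.restrictScalars ℚ ℝ _
    rw [← NormedSpace.exp_add_of_commute (Commute.neg_right (Commute.refl _)), add_neg_cancel,
      NormedSpace.exp_zero]
  refine ((hexp t).clm_apply ((hasDerivAt_integral_right
    (hexp_neg.clm_apply hf) 0 t).const_add y₀)).congr_deriv ?_
  rw [← mul_apply_eq_comp, hinv]
  simp [linSol]

theorem linSol_congr (a : E →L[ℝ] E) (y₀ : E) {f g : ℝ → E} {t : ℝ}
    (hfg : EqOn f g (uIcc 0 t)) : linSol a y₀ f t = linSol a y₀ g t := by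
  unfold linSol
  rw [intervalIntegral.integral_congr (g := fun s => NormedSpace.exp (-(s • a)) (g s))]
  intro s hs
  simp [hfg hs]

end VariationOfConstants

section DelayedFixedPoint

variable {X : Type*} {h : ℝ} {S : (ℝ → X) → ℝ → X} {φ : ℝ → X}

theorem iterate_eqOn_of_delay (hh : 0 ≤ h)
    (hdelay : ∀ ⦃x x' : ℝ → X⦄ ⦃t : ℝ⦄, EqOn x x' (Iic (t - h)) → S x t = S x' t)
    (hφ : EqOn (S φ) φ (Iic 0)) (k m : ℕ) : EqOn (S^[k + m] φ) (S^[k] φ) (Iic (k * h)) := by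
  have hsucc : ∀ k : ℕ, EqOn (S^[k + 1] φ) (S^[k] φ) (Iic (k * h)) := by
    intro k
    induction k with
    | zero => simpa using hφ
    | succ k ih =>
      intro t ht
      simp only [Function.iterate_succ_apply'] at ih ⊢
      refine hdelay (ih.mono (Iic_subset_Iic.2 ?_))
      rw [mem_Iic, Nat.cast_succ] at ht
      linarith
  induction m with
  | zero => exact eqOn_refl _ _
  | succ m ih =>
    refine (hsucc (k + m)).mono (Iic_subset_Iic.2 ?_) |>.trans ih
    gcongr
    exact Nat.le_add_right k m

theorem exists_fixedPoint_of_delay [TopologicalSpace X] (hh : 0 < h)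
    (hdelay : ∀ ⦃x x' : ℝ → X⦄ ⦃t : ℝ⦄, EqOn x x' (Iic (t - h)) → S x t = S x' t)
    (hφ : EqOn (S φ) φ (Iic 0)) (hcont : ∀ k, Continuous (S^[k] φ)) :
    ∃ x, Continuous x ∧ EqOn x φ (Iic 0) ∧ S x = x := by
  have hceil : ∀ t : ℝ, t ≤ ⌈t / h⌉₊ * h := fun t => (div_le_iff₀ hh).1 (Nat.le_ceil _)
  have hlarge : ∀ t : ℝ, ∃ k : ℕ, t < k * h := fun t =>
    (exists_nat_gt (t / h)).imp fun k hk => (div_lt_iff₀ hh).1 hk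
  let x : ℝ → X := fun t => S^[⌈t / h⌉₊] φ t
  have hx : ∀ k : ℕ, EqOn x (S^[k] φ) (Iic (k * h)) := fun k t ht => by
    obtain ⟨m, rfl⟩ := Nat.exists_eq_add_of_le (Nat.ceil_le.2 ((div_le_iff₀ hh).2 ht))
    exact (iterate_eqOn_of_delay hh.le hdelay hφ _ m (hceil t)).symm
  refine ⟨x, continuous_iff_continuousAt.2 fun t => ?_, by simpa using hx 0, funext fun t => ?_⟩
  · obtain ⟨k, hk⟩ := hlarge t
    refine (hcont k).continuousAt.congr ?_
    filter_upwards [Iio_mem_nhds hk] with s hs using (hx k (Iio_subset_Iic_self hs)).symm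
  · obtain ⟨k, hk⟩ := hlarge t
    have hk' : t ≤ (k + 1 : ℕ) * h := by push_cast; linarith
    rw [hx (k + 1) hk', Function.iterate_succ_apply']
    exact hdelay ((hx k).mono (Iic_subset_Iic.2 (by linarith)))

end DelayedFixedPoint

section MethodOfSteps

variable {E : Type*} [NormedAddCommGroup E] [NormedSpace ℝ E] {h : ℝ} {a₀ a₁ d : E →L[ℝ] E}
  {φ x y : ℝ → E}

/-- `x` is a continuous solution of `d/dt [x(t) - d x(t - h)] = a₀ x(t) + a₁ x(t - h)` for `t ≥ 0`
with `x = φ` for `t ≤ 0`, and `y` is the function `x(t) - d x(t - h)` on `t ≥ 0`. Since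
`y' = a₀ (y + d x(· - h)) + a₁ x(· - h)` involves only the past of `x`, this equation is imposed on
the whole line, which avoids one-sided derivatives at `0`. -/
structure IsContinuousSolution (h : ℝ) (a₀ a₁ d : E →L[ℝ] E) (φ x y : ℝ → E) : Prop where
  continuous : Continuous x
  initial : ∀ t ≤ 0, x t = φ t
  hasDerivAt : ∀ t, HasDerivAt y (a₀ (y t + d (x (t - h))) + a₁ (x (t - h))) t
  eq_add : ∀ t, 0 ≤ t → x t = y t + d (x (t - h))

theorem IsContinuousSolution.sub_eq (hx : IsContinuousSolution h a₀ a₁ d φ x y) {t : ℝ}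
    (ht : 0 ≤ t) : x t - d (x (t - h)) = y t :=
  sub_eq_of_eq_add (hx.eq_add t ht)

theorem IsContinuousSolution.hasDerivAt_of_nonneg (hx : IsContinuousSolution h a₀ a₁ d φ x y)
    {t : ℝ} (ht : 0 ≤ t) : HasDerivAt y (a₀ (x t) + a₁ (x (t - h))) t := by
  simpa only [hx.eq_add t ht] using hx.hasDerivAt t

theorem IsContinuousSolution.hasDerivAt_sub (hx : IsContinuousSolution h a₀ a₁ d φ x y)
    {t : ℝ} (ht : 0 < t) :
    HasDerivAt (fun s => x s - d (x (s - h))) (a₀ (x t) + a₁ (x (t - h))) t := by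
  refine (hx.hasDerivAt_of_nonneg ht.le).congr_of_eventuallyEq ?_
  filter_upwards [Ioi_mem_nhds ht] with s hs using hx.sub_eq (le_of_lt hs)

/-- The function `y` of `IsContinuousSolution` determined by the initial function `φ` and the past
of `x`. -/
def neutralPart (h : ℝ) (a₀ a₁ d : E →L[ℝ] E) (φ x : ℝ → E) : ℝ → E :=
  linSol a₀ (φ 0 - d (φ (-h))) fun s => a₀ (d (x (s - h))) + a₁ (x (s - h))

/-- One step of the method of steps: it turns a solution up to time `t - h` into one up to time
`t`. -/
def solutionStep (h : ℝ) (a₀ a₁ d : E →L[ℝ] E) (φ x : ℝ → E) (t : ℝ) : E :=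
  if t ≤ 0 then φ t else neutralPart h a₀ a₁ d φ x t + d (x (t - h))

theorem hasDerivAt_neutralPart [CompleteSpace E] (hx : Continuous x) (t : ℝ) :
    HasDerivAt (neutralPart h a₀ a₁ d φ x)
      (a₀ (neutralPart h a₀ a₁ d φ x t + d (x (t - h))) + a₁ (x (t - h))) t := by
  have : Continuous fun s => x (s - h) := hx.comp (continuous_sub_right h)
  have hforcing : Continuous fun s => a₀ (d (x (s - h))) + a₁ (x (s - h)) := by fun_prop
  refine (hasDerivAt_linSol a₀ _ hforcing t).congr_deriv ?_
  rw [map_add, add_assoc, neutralPart]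

theorem solutionStep_of_nonpos {t : ℝ} (ht : t ≤ 0) : solutionStep h a₀ a₁ d φ x t = φ t :=
  if_pos ht

theorem continuous_solutionStep [CompleteSpace E] (hφ : Continuous φ) (hx : Continuous x)
    (hxφ : x (-h) = φ (-h)) : Continuous (solutionStep h a₀ a₁ d φ x) := by
  have hy : Continuous (neutralPart h a₀ a₁ d φ x) :=
    continuous_iff_continuousAt.2 fun t => (hasDerivAt_neutralPart hx t).continuousAt
  refine Continuous.if_le hφ (hy.add (d.continuous.comp (hx.comp (continuous_sub_right h))))
    continuous_id continuous_const ?_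
  rintro t rfl
  simp [neutralPart, linSol_zero, hxφ]

theorem solutionStep_congr {x' : ℝ → E} {t : ℝ} (hxx' : EqOn x x' (Iic (t - h))) :
    solutionStep h a₀ a₁ d φ x t = solutionStep h a₀ a₁ d φ x' t := by
  unfold solutionStep
  split_ifs with ht
  · rfl
  · have hy : neutralPart h a₀ a₁ d φ x t = neutralPart h a₀ a₁ d φ x' t :=
      linSol_congr _ _ fun s hs => by
        rw [uIcc_of_le (not_le.1 ht).le] at hs
        simp only [hxx' (sub_le_sub_right hs.2 h)]
    rw [hy, hxx' self_mem_Iic]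

theorem continuous_iterate_solutionStep [CompleteSpace E] (hh : 0 ≤ h) (hφ : Continuous φ)
    (k : ℕ) : Continuous ((solutionStep h a₀ a₁ d φ)^[k] φ) := by
  have hinitial : ∀ k, (solutionStep h a₀ a₁ d φ)^[k] φ (-h) = φ (-h)
    | 0 => rfl
    | k + 1 => by
      rw [Function.iterate_succ_apply', solutionStep_of_nonpos (neg_nonpos.2 hh)]
  induction k with
  | zero => exact hφ
  | succ k ih =>
    rw [Function.iterate_succ_apply']
    exact continuous_solutionStep hφ ih (hinitial k)

theorem exists_isContinuousSolution [CompleteSpace E] (hh : 0 < h) (a₀ a₁ d : E →L[ℝ] E)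
    (hφ : Continuous φ) : ∃ x y, IsContinuousSolution h a₀ a₁ d φ x y := by
  obtain ⟨x, hx, hxφ, hfix⟩ := exists_fixedPoint_of_delay hh
    (fun x x' t => solutionStep_congr (h := h) (a₀ := a₀) (a₁ := a₁) (d := d) (φ := φ))
    (fun t ht => solutionStep_of_nonpos ht) (continuous_iterate_solutionStep hh.le hφ)
  refine ⟨x, neutralPart h a₀ a₁ d φ x, hx, hxφ, hasDerivAt_neutralPart hx, fun t ht => ?_⟩
  rcases ht.eq_or_lt with rfl | ht
  · rw [zero_sub, neutralPart, linSol_zero, hxφ self_mem_Iic, hxφ (neg_nonpos.2 hh.le),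
      sub_add_cancel]
  · rw [← congrFun hfix t, solutionStep, if_neg (not_le.2 ht)]

end MethodOfSteps

/-! ## Stability of the difference operator -/

section DecayOfDifferenceOperator

variable {E : Type*} [NormedAddCommGroup E] [NormedSpace ℝ E] {h γ σ B : ℝ}
  {a₀ a₁ d : E →L[ℝ] E} {φ ψ x y : ℝ → E}

theorem norm_sub_pow_apply_le (hh : 0 ≤ h) {δ : ℝ} (hx : ∀ t, 0 ≤ t → x t = y t + d (x (t - h)))
    (hy : ∀ t, 0 ≤ t → ‖y t‖ ≤ δ) {s : ℝ} (hs : -h ≤ s) (k : ℕ) :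
    ‖x (s + k * h) - (d ^ k) (x s)‖ ≤ (∑ i ∈ Finset.range k, ‖d‖ ^ i) * δ := by
  induction k with
  | zero => simp
  | succ k ih =>
    have hnonneg : 0 ≤ s + (k + 1 : ℕ) * h := by
      push_cast
      nlinarith [Nat.cast_nonneg (α := ℝ) k]
    have hshift : s + (k + 1 : ℕ) * h - h = s + k * h := by push_cast; ring
    rw [hx _ hnonneg, hshift, pow_succ', mul_apply_eq_comp, add_sub_assoc, ← map_sub]
    calc ‖y (s + (k + 1 : ℕ) * h) + d (x (s + k * h) - (d ^ k) (x s))‖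
        ≤ δ + ‖d‖ * ((∑ i ∈ Finset.range k, ‖d‖ ^ i) * δ) :=
          norm_add_le_of_le (hy _ hnonneg) (d.le_opNorm_of_le ih)
      _ = (∑ i ∈ Finset.range (k + 1), ‖d‖ ^ i) * δ := by rw [geom_sum_succ]; ring

/-- Exponential decay, with rate `σ` and constant `γ`, of the continuous solutions with
continuously differentiable initial functions. -/
def HasExpDecay (h : ℝ) (a₀ a₁ d : E →L[ℝ] E) (γ σ : ℝ) : Prop :=
  ∀ ⦃φ x y : ℝ → E⦄, ContDiff ℝ 1 φ → IsContinuousSolution h a₀ a₁ d φ x y →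
    ∀ ⦃B : ℝ⦄, (∀ θ ∈ Icc (-h) 0, ‖φ θ‖ ≤ B) → ∀ t, 0 ≤ t → ‖x t‖ ≤ γ * Real.exp (-σ * t) * B

theorem HasExpDecay.norm_le (H : HasExpDecay h a₀ a₁ d γ σ) (hh : 0 ≤ h) (hγ : 0 ≤ γ)
    (hσ : 0 ≤ σ) (hφ : ContDiff ℝ 1 φ) (hx : IsContinuousSolution h a₀ a₁ d φ x y)
    (hB : ∀ θ ∈ Icc (-h) 0, ‖φ θ‖ ≤ B) {t : ℝ} (ht : -h ≤ t) : ‖x t‖ ≤ (γ + 1) * B := by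
  have hB₀ : 0 ≤ B := (norm_nonneg _).trans (hB 0 ⟨neg_nonpos.2 hh, le_rfl⟩)
  rcases le_total t 0 with ht₀ | ht₀
  · rw [hx.initial t ht₀]
    exact (hB t ⟨ht, ht₀⟩).trans (le_mul_of_one_le_left hB₀ (by linarith))
  · have hexp : Real.exp (-σ * t) ≤ 1 := Real.exp_le_one_iff.2 (by nlinarith)
    calc ‖x t‖ ≤ γ * Real.exp (-σ * t) * B := H hφ hx hB t ht₀
      _ ≤ γ * 1 * B := by gcongr
      _ ≤ (γ + 1) * B := by linarith

theorem HasExpDecay.tendsto_zero (H : HasExpDecay h a₀ a₁ d γ σ) (hσ : 0 < σ)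
    (hφ : ContDiff ℝ 1 φ) (hx : IsContinuousSolution h a₀ a₁ d φ x y)
    (hB : ∀ θ ∈ Icc (-h) 0, ‖φ θ‖ ≤ B) : Tendsto x atTop (𝓝 0) := by
  have hexp : Tendsto (fun t => Real.exp (-σ * t)) atTop (𝓝 0) :=
    Real.tendsto_exp_atBot.comp (tendsto_id.const_mul_atTop_of_neg (neg_lt_zero.2 hσ))
  refine squeeze_zero_norm' (a := fun t => γ * Real.exp (-σ * t) * B) ?_
    (by simpa using (hexp.const_mul γ).mul_const B)
  filter_upwards [eventually_ge_atTop 0] with t ht using H hφ hx hB t ht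

theorem norm_add_apply_le {r : ℝ} {u v : E} (hu : ‖u‖ ≤ r) (hv : ‖v‖ ≤ r) :
    ‖a₀ u + a₁ v‖ ≤ (‖a₀‖ + ‖a₁‖) * r := by
  rw [add_mul]
  exact norm_add_le_of_le (a₀.le_opNorm_of_le hu) (a₁.le_opNorm_of_le hv)

theorem hasDerivAt_one_sub_cos_smul {ω : ℝ} (hω : ω ≠ 0) (v : E) (t : ℝ) :
    HasDerivAt (fun s => ((1 - Real.cos (ω * s)) / ω) • v) (Real.sin (ω * t) • v) t := by
  have hlin : HasDerivAt (fun s => ω * s) ω t := by simpa using (hasDerivAt_id t).const_mul ω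
  refine (((hlin.cos.const_sub 1).div_const ω).smul_const v).congr_deriv ?_
  congr 1
  field_simp

theorem norm_one_sub_cos_smul_le {ω : ℝ} (hω : 0 < ω) (v : E) (t : ℝ) :
    ‖((1 - Real.cos (ω * t)) / ω) • v‖ ≤ 2 / ω * ‖v‖ := by
  rw [norm_smul, Real.norm_eq_abs, abs_div, abs_of_pos hω]
  gcongr
  rw [abs_le]
  constructor <;> linarith [Real.neg_one_le_cos (ω * t), Real.cos_le_one (ω * t)]

variable [CompleteSpace E]

theorem IsContinuousSolution.primitive_initial (hx : IsContinuousSolution h a₀ a₁ d φ x y)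
    (hψ : ∀ t, HasDerivAt ψ (φ t) t) (hφ : Continuous φ) {t : ℝ} (ht : t ≤ 0) :
    ψ 0 + ∫ s in (0 : ℝ)..t, x s = ψ t := by
  have hint : ∫ s in (0 : ℝ)..t, x s = ∫ s in (0 : ℝ)..t, φ s := by
    refine intervalIntegral.integral_congr fun s hs => hx.initial s ?_
    rw [uIcc_of_ge ht] at hs
    exact hs.2
  rw [hint, intervalIntegral.integral_eq_sub_of_hasDerivAt (fun s _ => hψ s)
    (hφ.intervalIntegrable _ _), add_sub_cancel]

theorem IsContinuousSolution.primitive (hx : IsContinuousSolution h a₀ a₁ d φ x y) (hh : 0 ≤ h)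
    (hψ : ∀ t, HasDerivAt ψ (φ t) t) (hφ : Continuous φ)
    (hcompat : φ 0 - d (φ (-h)) = a₀ (ψ 0) + a₁ (ψ (-h))) :
    IsContinuousSolution h a₀ a₁ d ψ (fun t => ψ 0 + ∫ s in (0 : ℝ)..t, x s)
      (fun t => ψ 0 - d (ψ (-h)) + ∫ s in (0 : ℝ)..t, y s) := by
  set X : ℝ → E := fun t => ψ 0 + ∫ s in (0 : ℝ)..t, x s
  set Y : ℝ → E := fun t => ψ 0 - d (ψ (-h)) + ∫ s in (0 : ℝ)..t, y s
  have hy : Continuous y := continuous_iff_continuousAt.2 fun t => (hx.hasDerivAt t).continuousAt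
  have hX : ∀ t, HasDerivAt X (x t) t := fun t =>
    (hasDerivAt_integral_right hx.continuous 0 t).const_add _
  have hX' : ∀ t, HasDerivAt (fun s => X (s - h)) (x (t - h)) t := fun t =>
    (hX (t - h)).comp_sub_const t h
  have hY : ∀ t, HasDerivAt Y (y t) t := fun t => (hasDerivAt_integral_right hy 0 t).const_add _
  have hXψ : ∀ t ≤ 0, X t = ψ t := fun t ht => hx.primitive_initial hψ hφ ht
  refine ⟨continuous_iff_continuousAt.2 fun t => (hX t).continuousAt, hXψ, fun t => ?_,
    fun t ht => ?_⟩
  · refine (hY t).congr_deriv ?_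
    have hdiff : ∀ t, HasDerivAt
        (fun t => y t - (a₀ (Y t + d (X (t - h))) + a₁ (X (t - h)))) 0 t := fun t =>
      ((hx.hasDerivAt t).sub ((a₀.hasFDerivAt.comp_hasDerivAt t ((hY t).add
        (d.hasFDerivAt.comp_hasDerivAt t (hX' t)))).add
        (a₁.hasFDerivAt.comp_hasDerivAt t (hX' t)))).congr_deriv (sub_self _)
    have hconst := is_const_of_deriv_eq_zero (fun t => (hdiff t).differentiableAt)
      (fun t => (hdiff t).deriv) t 0
    have hzero : y 0 - (a₀ (Y 0 + d (X (0 - h))) + a₁ (X (0 - h))) = 0 := by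
      rw [← hx.sub_eq le_rfl, zero_sub, hx.initial 0 le_rfl, hx.initial (-h) (by linarith), hcompat,
        hXψ (-h) (by linarith)]
      simp [Y]
    exact sub_eq_zero.1 (hconst.trans hzero)
  · refine eq_of_has_deriv_right_eq (a := 0) (b := t) (f := X) (f' := x)
      (g := fun t => Y t + d (X (t - h))) (fun s _ => (hX s).hasDerivWithinAt)
      (fun s hs => ?_) (fun s _ => (hX s).continuousAt.continuousWithinAt)
      (fun s _ => ?_) ?_ t ⟨ht, le_rfl⟩
    · rw [hx.eq_add s hs.1]
      exact ((hY s).add (d.hasFDerivAt.comp_hasDerivAt s (hX' s))).hasDerivWithinAt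
    · exact ((hY s).add (d.hasFDerivAt.comp_hasDerivAt s
        (hX' s))).continuousAt.continuousWithinAt
    · simp [hXψ (-h) (by linarith), X, Y]

/-- The difference `y = x - d x(· - h)` is the derivative of the corresponding difference of the
primitive of `x`, so it is controlled by the primitive `ψ` of the initial function, which may be
much smaller than `φ` itself. -/
theorem HasExpDecay.norm_pow_apply_le (H : HasExpDecay h a₀ a₁ d γ σ) (hh : 0 < h) (hγ : 0 ≤ γ)
    (hσ : 0 ≤ σ) (hφ : ContDiff ℝ 1 φ) (hψ : ∀ t, HasDerivAt ψ (φ t) t)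
    (hcompat : φ 0 - d (φ (-h)) = a₀ (ψ 0) + a₁ (ψ (-h))) {B' : ℝ}
    (hB : ∀ θ ∈ Icc (-h) 0, ‖φ θ‖ ≤ B) (hB' : ∀ θ ∈ Icc (-h) 0, ‖ψ θ‖ ≤ B') {s : ℝ}
    (hs : s ∈ Icc (-h) 0) {k : ℕ} (hk : 1 ≤ k) :
    ‖(d ^ k) (φ s)‖ ≤ γ * Real.exp (-σ * (s + k * h)) * B +
      (∑ i ∈ Finset.range k, ‖d‖ ^ i) * ((‖a₀‖ + ‖a₁‖) * ((γ + 1) * B')) := by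
  obtain ⟨x, y, hx⟩ := exists_isContinuousSolution hh a₀ a₁ d hφ.continuous
  have hy : Continuous y := continuous_iff_continuousAt.2 fun t => (hx.hasDerivAt t).continuousAt
  have hψ₁ : ContDiff ℝ 1 ψ := contDiff_one_iff_deriv.2
    ⟨fun t => (hψ t).differentiableAt, by simpa only [funext fun t => (hψ t).deriv] using
      hφ.continuous⟩
  have hX := hx.primitive hh.le hψ hφ.continuous hcompat
  have hy_le : ∀ t, 0 ≤ t → ‖y t‖ ≤ (‖a₀‖ + ‖a₁‖) * ((γ + 1) * B') := fun t ht => by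
    rw [((hasDerivAt_integral_right hy 0 t).const_add _).unique (hX.hasDerivAt_of_nonneg ht)]
    exact norm_add_apply_le (H.norm_le hh.le hγ hσ hψ₁ hX hB' (by linarith))
      (H.norm_le hh.le hγ hσ hψ₁ hX hB' (by linarith))
  have hdiff := norm_sub_pow_apply_le hh.le hx.eq_add hy_le hs.1 k
  have hk' : (1 : ℝ) ≤ k := mod_cast hk
  have hdecay := H hφ hx hB (s + k * h) (by nlinarith [hs.1])
  rw [← hx.initial s hs.2]
  exact (norm_le_insert _ _).trans (add_le_add hdecay hdiff)

theorem HasExpDecay.norm_pow_apply_le_of_frequency (H : HasExpDecay h a₀ a₁ d γ σ) (hh : 0 < h)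
    (hγ : 0 ≤ γ) (hσ : 0 ≤ σ) (v : E) {k : ℕ} (hk : 1 ≤ k) {ω : ℝ} {m : ℕ}
    (hω : ω * h = (m + 1 : ℕ) * (2 * Real.pi)) :
    ‖(d ^ k) v‖ ≤ γ * Real.exp (-σ * ((k - 1) * h)) * ‖v‖ +
      (∑ i ∈ Finset.range k, ‖d‖ ^ i) * ((‖a₀‖ + ‖a₁‖) * ((γ + 1) * (2 / ω * ‖v‖))) := by
  have hω₀ : 0 < ω := pos_of_mul_pos_left (hω ▸ by positivity) hh.le
  have hsin : Real.sin (ω * h) = 0 := by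
    rw [hω]
    simpa using Real.sin_add_nat_mul_two_pi 0 (m + 1)
  have hcos : Real.cos (ω * h) = 1 := hω ▸ Real.cos_nat_mul_two_pi _
  have hφ_le : ∀ t, ‖Real.sin (ω * t) • v‖ ≤ ‖v‖ := fun t => by
    rw [norm_smul]
    exact mul_le_of_le_one_left (norm_nonneg _) (Real.abs_sin_le_one _)
  obtain ⟨s, hs, hωs⟩ : ∃ s ∈ Icc (-h) 0, ω * s = Real.pi / 2 - 2 * Real.pi := by
    refine ⟨(Real.pi / 2 - 2 * Real.pi) / ω, ⟨?_, ?_⟩, mul_div_cancel₀ _ hω₀.ne'⟩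
    · rw [le_div_iff₀ hω₀, neg_mul, mul_comm h, hω]
      push_cast
      nlinarith [Real.pi_pos, Nat.cast_nonneg (α := ℝ) m]
    · exact div_nonpos_of_nonpos_of_nonneg (by linarith [Real.pi_pos]) hω₀.le
  have hbound := H.norm_pow_apply_le hh hγ hσ (φ := fun s => Real.sin (ω * s) • v) (by fun_prop)
    (hasDerivAt_one_sub_cos_smul hω₀.ne' v) (by simp [hsin, hcos]) (fun θ _ => hφ_le θ)
    (fun θ _ => norm_one_sub_cos_smul_le hω₀ v θ) hs hk
  simp only [hωs, Real.sin_sub_two_pi, Real.sin_pi_div_two, one_smul] at hbound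
  refine hbound.trans ?_
  gcongr ?_ * Real.exp ?_ * _ + _
  nlinarith [hs.1]

theorem HasExpDecay.norm_pow_apply_le_exp (H : HasExpDecay h a₀ a₁ d γ σ) (hh : 0 < h)
    (hγ : 0 ≤ γ) (hσ : 0 ≤ σ) (v : E) {k : ℕ} (hk : 1 ≤ k) :
    ‖(d ^ k) v‖ ≤ γ * Real.exp (-σ * ((k - 1) * h)) * ‖v‖ := by
  set ω : ℕ → ℝ := fun m => (m + 1 : ℕ) * (2 * Real.pi) / h
  have hω : Tendsto (fun m => 2 / ω m) atTop (𝓝 0) :=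
    Tendsto.div_atTop tendsto_const_nhds (Tendsto.atTop_div_const hh
      (((tendsto_natCast_atTop_atTop).comp (tendsto_add_atTop_nat 1)).atTop_mul_const
        Real.two_pi_pos))
  have hlim := ((((hω.mul_const ‖v‖).const_mul (γ + 1)).const_mul (‖a₀‖ + ‖a₁‖)).const_mul
    (∑ i ∈ Finset.range k, ‖d‖ ^ i)).const_add (γ * Real.exp (-σ * ((k - 1) * h)) * ‖v‖)
  have hbound := ge_of_tendsto' hlim fun m =>
    H.norm_pow_apply_le_of_frequency hh hγ hσ v hk (ω := ω m) (m := m) (div_mul_cancel₀ _ hh.ne')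
  simpa using hbound

theorem HasExpDecay.tendsto_pow_apply (H : HasExpDecay h a₀ a₁ d γ σ) (hh : 0 < h) (hγ : 0 ≤ γ)
    (hσ : 0 < σ) (v : E) : Tendsto (fun k : ℕ => (d ^ k) v) atTop (𝓝 0) := by
  refine squeeze_zero_norm' (a := fun k : ℕ => γ * Real.exp (-σ * ((k - 1) * h)) * ‖v‖) ?_ ?_
  · filter_upwards [eventually_ge_atTop 1] with k hk
      using H.norm_pow_apply_le_exp hh hγ hσ.le v hk
  · have hexponent : Tendsto (fun k : ℕ => -σ * (((k : ℝ) - 1) * h)) atTop atBot :=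
      ((tendsto_atTop_add_const_right _ (-1) tendsto_natCast_atTop_atTop).atTop_mul_const
        hh).const_mul_atTop_of_neg (neg_lt_zero.2 hσ)
    simpa using ((Real.tendsto_exp_atBot.comp hexponent).const_mul γ).mul_const ‖v‖

end DecayOfDifferenceOperator

section MatrixAction

variable {ι : Type*} [Fintype ι]

/-- Multiplication of vectors by a matrix as a continuous linear map. -/
def mulVecCLM (A : Matrix ι ι ℝ) : (ι → ℝ) →L[ℝ] (ι → ℝ) :=
  LinearMap.toContinuousLinearMap A.mulVecLin

@[simp] theorem mulVecCLM_apply (A : Matrix ι ι ℝ) (v : ι → ℝ) :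
    mulVecCLM A v = A *ᵥ v := rfl

theorem mulVecCLM_pow_apply [DecidableEq ι] (A : Matrix ι ι ℝ) (k : ℕ) (v : ι → ℝ) :
    (mulVecCLM A ^ k) v = A ^ k *ᵥ v := by
  induction k with
  | zero => simp
  | succ k ih =>
    rw [pow_succ', mul_apply_eq_comp, ih, mulVecCLM_apply, mulVec_mulVec, pow_succ']

end MatrixAction

section ExponentialStability

variable {n : ℕ}

theorem norm_le_eucl (v : Fin n → ℝ) : ‖v‖ ≤ eucl v :=
  (pi_norm_le_iff_of_nonneg (norm_nonneg _)).2 fun i => PiLp.norm_apply_le (WithLp.toLp 2 v) i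

theorem exists_eucl_le_mul_norm (n : ℕ) : ∃ c : ℝ, 0 ≤ c ∧ ∀ v : Fin n → ℝ, eucl v ≤ c * ‖v‖ :=
  ⟨_, norm_nonneg _, fun v =>
    ((PiLp.continuousLinearEquiv 2 ℝ fun _ : Fin n => ℝ).symm.toContinuousLinearMap).le_opNorm v⟩

theorem supNorm_le {h B : ℝ} (hh : 0 ≤ h) {φ : ℝ → Fin n → ℝ}
    (hB : ∀ θ ∈ Icc (-h) 0, eucl (φ θ) ≤ B) : supNorm h φ ≤ B :=
  csSup_le ((nonempty_Icc.2 (neg_nonpos.2 hh)).image _) (forall_mem_image.2 hB)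

theorem isPCOn_of_continuous {f : ℝ → Fin n → ℝ} (hf : Continuous f) (a b : ℝ) : IsPCOn f a b :=
  ⟨⟨∅, fun _ _ _ => hf.continuousAt⟩,
    fun t _ => ⟨_, (hf.tendsto t).mono_left nhdsWithin_le_nhds⟩,
    fun t _ => ⟨_, (hf.tendsto t).mono_left nhdsWithin_le_nhds⟩⟩

theorem isPC1On_of_contDiff {φ : ℝ → Fin n → ℝ} (hφ : ContDiff ℝ 1 φ) (a b : ℝ) :
    IsPC1On φ a b := by
  obtain ⟨-, hright, hleft⟩ := isPCOn_of_continuous hφ.continuous a b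
  obtain ⟨-, hright', hleft'⟩ := isPCOn_of_continuous (hφ.continuous_deriv le_rfl) a b
  exact ⟨⟨∅, fun t _ _ => hφ.contDiffAt⟩, fun t ht => ⟨hright t ht, hright' t ht⟩,
    fun t ht => ⟨hleft t ht, hleft' t ht⟩⟩

variable {h : ℝ} {A₀ A₁ D : Matrix (Fin n) (Fin n) ℝ}

theorem IsContinuousSolution.isSolution {φ x y : ℝ → Fin n → ℝ}
    (hx : IsContinuousSolution h (mulVecCLM A₀) (mulVecCLM A₁) (mulVecCLM D) φ x y) :
    IsSolution h A₀ A₁ D φ x where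
  initial θ hθ := hx.initial θ hθ.2
  piecewise _ _ := isPCOn_of_continuous hx.continuous _ _
  continuous_diff := (hx.continuous.sub ((mulVecCLM D).continuous.comp
    (hx.continuous.comp (continuous_sub_right h)))).continuousOn
  equation := ⟨∅, countable_empty, fun _ ht _ => hx.hasDerivAt_sub ht⟩

theorem ExpStable.exists_hasExpDecay (hh : 0 ≤ h) (hs : ExpStable h A₀ A₁ D) :
    ∃ γ ≥ 0, ∃ σ > 0, HasExpDecay h (mulVecCLM A₀) (mulVecCLM A₁) (mulVecCLM D) γ σ := by
  obtain ⟨γ, hγ, σ, hσ, hdecay⟩ := hs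
  obtain ⟨c, hc, hc_le⟩ := exists_eucl_le_mul_norm n
  refine ⟨γ * c, by positivity, σ, hσ, fun φ x y hφ hx B hB t ht => ?_⟩
  have hsup : supNorm h φ ≤ c * B := supNorm_le hh fun θ hθ =>
    (hc_le _).trans (mul_le_mul_of_nonneg_left (hB θ hθ) hc)
  calc ‖x t‖ ≤ eucl (x t) := norm_le_eucl _
    _ ≤ γ * Real.exp (-σ * t) * supNorm h φ :=
      hdecay φ (isPC1On_of_contDiff hφ _ _) x hx.isSolution t ht
    _ ≤ γ * Real.exp (-σ * t) * (c * B) := by gcongr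
    _ = γ * c * Real.exp (-σ * t) * B := by ring

theorem ExpStable.tendsto_pow (hh : 0 < h) (hs : ExpStable h A₀ A₁ D) :
    Tendsto (fun k : ℕ => D ^ k) atTop (𝓝 0) := by
  obtain ⟨γ, hγ, σ, hσ, hdecay⟩ := hs.exists_hasExpDecay hh.le
  refine tendsto_pi_nhds.2 fun i => tendsto_pi_nhds.2 fun j => ?_
  have hcol := tendsto_pi_nhds.1 (hdecay.tendsto_pow_apply hh hγ hσ (Pi.single j 1)) i
  simp only [mulVecCLM_pow_apply, mulVec_single_one] at hcol
  exact hcol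

end ExponentialStability

section Stein

variable {ι : Type*} [Fintype ι] [DecidableEq ι]

/-- The Stein map `X ↦ X - Dᵀ X D`. -/
def steinMap (D : Matrix ι ι ℝ) : Matrix ι ι ℝ →ₗ[ℝ] Matrix ι ι ℝ :=
  LinearMap.id - LinearMap.mulRight ℝ D ∘ₗ LinearMap.mulLeft ℝ Dᵀ

theorem steinMap_apply (D X : Matrix ι ι ℝ) : steinMap D X = X - Dᵀ * X * D := rfl

theorem steinMap_injective {D : Matrix ι ι ℝ}
    (hD : Tendsto (fun k : ℕ => D ^ k) atTop (𝓝 0)) : Function.Injective (steinMap D) := by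
  refine (injective_iff_map_eq_zero _).2 fun X hX => ?_
  have hfix : ∀ k : ℕ, (D ^ k)ᵀ * X * D ^ k = X := fun k => by
    induction k with
    | zero => simp
    | succ k ih =>
      calc (D ^ (k + 1))ᵀ * X * D ^ (k + 1) = Dᵀ * ((D ^ k)ᵀ * X * D ^ k) * D := by
            rw [pow_succ, transpose_mul]
            noncomm_ring
        _ = X := by rw [ih, ← sub_eq_zero.1 ((steinMap_apply D X).symm.trans hX)]
  have hcont : Continuous fun Y : Matrix ι ι ℝ => Yᵀ * X * Y := by fun_prop
  have hlim := (hcont.tendsto 0).comp hD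
  simp only [Function.comp_def, hfix, mul_zero] at hlim
  exact tendsto_nhds_unique tendsto_const_nhds hlim

end Stein

/-! ## Regularity of the delay Lyapunov matrix -/

section ReflectedEquation

variable {E : Type*} [NormedAddCommGroup E] [NormedSpace ℝ E] [CompleteSpace E] {h : ℝ}
  {l₁ l₂ : E →L[ℝ] E} {f : ℝ → E}

theorem exists_primitive_extension (hf : ContinuousOn f (Icc 0 h))
    (hf' : ∀ θ ∈ Ioo 0 h, HasDerivAt f (l₁ (f θ) + l₂ (f (h - θ))) θ) {g : ℝ → E}
    (hg : Continuous g) (hgf : EqOn g f (Icc 0 h)) :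
    ∃ V : ℝ → E, EqOn V f (Icc 0 h) ∧ ∀ t, HasDerivAt V (l₁ (g t) + l₂ (g (h - t))) t := by
  have hcont : Continuous fun t => l₁ (g t) + l₂ (g (h - t)) := by fun_prop
  refine ⟨fun θ => f 0 + ∫ s in (0 : ℝ)..θ, (l₁ (g s) + l₂ (g (h - s))), fun θ hθ => ?_,
    fun t => (hasDerivAt_integral_right hcont 0 t).const_add _⟩
  simp only
  rw [intervalIntegral.integral_eq_sub_of_hasDerivAt_of_le hθ.1
    (hf.mono (Icc_subset_Icc_right hθ.2)) (fun s hs => ?_) (hcont.intervalIntegrable _ _),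
    add_sub_cancel]
  have hs' : s ∈ Ioo 0 h := ⟨hs.1, hs.2.trans_le hθ.2⟩
  rw [hgf (Ioo_subset_Icc_self hs'), hgf ⟨sub_nonneg.2 hs'.2.le, sub_le_self _ hs'.1.le⟩]
  exact hf' s hs'

/-- Each use of `exists_primitive_extension` gains one derivative. -/
theorem exists_extension_hasDerivAt_hasDerivAt (hh : 0 ≤ h) (hf : ContinuousOn f (Icc 0 h))
    (hf' : ∀ θ ∈ Ioo 0 h, HasDerivAt f (l₁ (f θ) + l₂ (f (h - θ))) θ) :
    ∃ V V₁ V₂ : ℝ → E, (∀ t, HasDerivAt V (V₁ t) t) ∧ (∀ t, HasDerivAt V₁ (V₂ t) t) ∧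
      Continuous V₂ ∧ EqOn V f (Icc 0 h) := by
  set g : ℝ → E := IccExtend hh ((Icc 0 h).domRestrict f)
  have hg : Continuous g := (continuousOn_iff_continuous_domRestrict.1 hf).Icc_extend'
  obtain ⟨G, hGf, hG⟩ := exists_primitive_extension hf hf' hg
    fun θ hθ => IccExtend_of_mem _ _ hθ
  obtain ⟨V, hVf, hV⟩ := exists_primitive_extension hf hf'
    (continuous_iff_continuousAt.2 fun t => (hG t).continuousAt) hGf
  set g' : ℝ → E := fun t => l₁ (g t) + l₂ (g (h - t))
  have hg' : Continuous g' := by fun_prop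
  refine ⟨V, fun t => l₁ (G t) + l₂ (G (h - t)), fun t => l₁ (g' t) + l₂ (-g' (h - t)), hV,
    fun t => ?_, by fun_prop, hVf⟩
  exact (l₁.hasFDerivAt.comp_hasDerivAt t (hG t)).add
    (l₂.hasFDerivAt.comp_hasDerivAt t ((hG (h - t)).comp_const_sub h t))

end ReflectedEquation

section MatrixDerivative

open scoped Matrix.Norms.Elementwise

theorem hasDerivAt_matrix_iff {ι κ : Type*} [Finite κ] {M : ℝ → Matrix ι κ ℝ}
    {M' : Matrix ι κ ℝ} {t : ℝ} :
    HasDerivAt M M' t ↔ ∀ i j, HasDerivAt (fun s => M s i j) (M' i j) t := by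
  cases nonempty_fintype κ
  exact ⟨fun hM i j => hasDerivAt_pi.1 (hasDerivAt_pi.1 hM i) j,
    fun hM => hasDerivAt_pi.2 fun i => hasDerivAt_pi.2 (hM i)⟩

variable {n : ℕ}

theorem hasDerivAt_linearMap {E F : Type*} [NormedAddCommGroup E] [NormedSpace ℝ E]
    [FiniteDimensional ℝ E] [NormedAddCommGroup F] [NormedSpace ℝ F] (l : E →ₗ[ℝ] F)
    {f : ℝ → E} {f' : E} {t : ℝ} (hf : HasDerivAt f f' t) :
    HasDerivAt (fun s => l (f s)) (l f') t :=
  (LinearMap.toContinuousLinearMap l).hasFDerivAt.comp_hasDerivAt t hf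

theorem hasDerivAt_transpose {ι κ : Type*} [Finite ι] [Finite κ] {M : ℝ → Matrix ι κ ℝ}
    {M' : Matrix ι κ ℝ} {t : ℝ} (hM : HasDerivAt M M' t) :
    HasDerivAt (fun s => (M s)ᵀ) M'ᵀ t :=
  hasDerivAt_matrix_iff.2 fun i j => hasDerivAt_matrix_iff.1 hM j i

theorem hasDerivAt_mulVec_const {ι κ : Type*} [Fintype κ] {M : ℝ → Matrix ι κ ℝ}
    {M' : Matrix ι κ ℝ} {t : ℝ} (hM : HasDerivAt M M' t) (v : κ → ℝ) :
    HasDerivAt (fun s => M s *ᵥ v) (M' *ᵥ v) t :=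
  hasDerivAt_pi.2 fun i => HasDerivAt.fun_sum fun j _ =>
    (hasDerivAt_matrix_iff.1 hM i j).mul_const (v j)

theorem hasDerivAt_dotProduct {ι : Type*} [Fintype ι] {u v : ℝ → ι → ℝ} {u' v' : ι → ℝ} {t : ℝ}
    (hu : HasDerivAt u u' t) (hv : HasDerivAt v v' t) :
    HasDerivAt (fun s => u s ⬝ᵥ v s) (u' ⬝ᵥ v t + u t ⬝ᵥ v') t :=
  (HasDerivAt.fun_sum fun i _ => (hasDerivAt_pi.1 hu i).mul (hasDerivAt_pi.1 hv i)).congr_deriv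
    Finset.sum_add_distrib

theorem mderiv_eq_of_hasDerivAt {M : ℝ → Matrix (Fin n) (Fin n) ℝ}
    {M' : Matrix (Fin n) (Fin n) ℝ} {t : ℝ} (hM : HasDerivAt M M' t) : mderiv M t = M' :=
  Matrix.ext fun i j => (hasDerivAt_matrix_iff.1 hM i j).deriv

theorem mderiv_neg_of_eq_transpose {h θ : ℝ} {F G : ℝ → Matrix (Fin n) (Fin n) ℝ}
    {F' : Matrix (Fin n) (Fin n) ℝ} (hFG : ∀ s ∈ Ioo 0 h, G (-s) = (F s)ᵀ) (hθ : θ ∈ Ioo 0 h)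
    (hF : HasDerivAt F F' θ) : mderiv G (-θ) = -F'ᵀ := by
  have hrefl : HasDerivAt (fun s => (F (-s))ᵀ) (-F')ᵀ (-θ) := by
    rw [← neg_neg θ] at hF
    simpa using hasDerivAt_transpose (hF.scomp (-θ) (hasDerivAt_neg (-θ)))
  rw [← transpose_neg]
  refine mderiv_eq_of_hasDerivAt (hrefl.congr_of_eventuallyEq ?_)
  filter_upwards [Ioo_mem_nhds (neg_lt_neg hθ.2) (neg_lt_zero.2 hθ.1)] with s hs
  rw [← hFG (-s) ⟨neg_pos.2 hs.2, neg_lt.1 hs.1⟩, neg_neg]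

end MatrixDerivative

section DelayLyapunovMatrix

open scoped Matrix.Norms.Elementwise

variable {n : ℕ} {h : ℝ} {A₀ A₁ D W P : Matrix (Fin n) (Fin n) ℝ}
  {U : ℝ → Matrix (Fin n) (Fin n) ℝ}

theorem IsDelayLyapunovMatrix.hasDerivAt (hU : IsDelayLyapunovMatrix h A₀ A₁ D W U P) {θ : ℝ}
    (hθ : θ ∈ Ioo 0 h) : HasDerivAt U (mderiv U θ) θ :=
  hasDerivAt_matrix_iff.2 fun i j => (hU.differentiable θ hθ i j).1.hasDerivAt

theorem IsDelayLyapunovMatrix.apply_neg (hU : IsDelayLyapunovMatrix h A₀ A₁ D W U P) {θ : ℝ}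
    (hθ : θ ∈ Icc 0 h) : U (-θ) = (U θ)ᵀ :=
  (hU.symmetry θ ⟨by linarith [hθ.1, hθ.2], hθ.2⟩).symm

theorem IsDelayLyapunovMatrix.mderiv_neg (hU : IsDelayLyapunovMatrix h A₀ A₁ D W U P) {θ : ℝ}
    (hθ : θ ∈ Ioo 0 h) : mderiv U (-θ) = -(mderiv U θ)ᵀ :=
  mderiv_neg_of_eq_transpose (fun _ hs => hU.apply_neg (Ioo_subset_Icc_self hs)) hθ
    (hU.hasDerivAt hθ)

theorem IsDelayLyapunovMatrix.transpose_dynamic (hU : IsDelayLyapunovMatrix h A₀ A₁ D W U P)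
    {θ : ℝ} (hθ : θ ∈ Ioo 0 h) :
    (mderiv U θ)ᵀ + Dᵀ * mderiv U (h - θ) = A₀ᵀ * (U θ)ᵀ + A₁ᵀ * U (h - θ) := by
  have hθ' : h - θ ∈ Ioo 0 h := ⟨sub_pos.2 hθ.2, sub_lt_self _ hθ.1⟩
  have hdyn := hU.dynamic θ hθ
  rw [← neg_sub h θ, hU.mderiv_neg hθ', hU.apply_neg (Ioo_subset_Icc_self hθ')] at hdyn
  simpa using congrArg transpose hdyn

/-- Eliminating `U'(h - θ)` between the dynamic equations at `θ` and at `h - θ`. -/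
theorem IsDelayLyapunovMatrix.steinMap_mderiv (hU : IsDelayLyapunovMatrix h A₀ A₁ D W U P)
    {θ : ℝ} (hθ : θ ∈ Ioo 0 h) :
    steinMap D (mderiv U θ) = (U θ * A₀ - A₁ᵀ * U θ * D) +
      ((U (h - θ))ᵀ * A₁ - A₀ᵀ * (U (h - θ))ᵀ * D) := by
  have hθ' : h - θ ∈ Ioo 0 h := ⟨sub_pos.2 hθ.2, sub_lt_self _ hθ.1⟩
  have hdyn := congrArg transpose (hU.transpose_dynamic hθ)
  have hdyn' := hU.transpose_dynamic hθ'
  simp only [transpose_add, transpose_mul, transpose_transpose] at hdyn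
  rw [sub_sub_cancel] at hdyn'
  calc steinMap D (mderiv U θ)
      = (mderiv U θ + (mderiv U (h - θ))ᵀ * D) -
          ((mderiv U (h - θ))ᵀ + Dᵀ * mderiv U θ) * D := by
        rw [steinMap_apply]
        noncomm_ring
    _ = (U θ * A₀ - A₁ᵀ * U θ * D) + ((U (h - θ))ᵀ * A₁ - A₀ᵀ * (U (h - θ))ᵀ * D) := by
        rw [hdyn, hdyn']
        noncomm_ring

theorem IsDelayLyapunovMatrix.exists_hasDerivAt (hU : IsDelayLyapunovMatrix h A₀ A₁ D W U P)
    (hD : Function.Injective (steinMap D)) :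
    ∃ l₁ l₂ : Matrix (Fin n) (Fin n) ℝ →L[ℝ] Matrix (Fin n) (Fin n) ℝ,
      ∀ θ ∈ Ioo 0 h, HasDerivAt U (l₁ (U θ) + l₂ (U (h - θ))) θ := by
  let steinEquiv := LinearEquiv.ofInjectiveEndo (steinMap D) hD
  let r₁ : Matrix (Fin n) (Fin n) ℝ →ₗ[ℝ] Matrix (Fin n) (Fin n) ℝ :=
    LinearMap.mulRight ℝ A₀ - LinearMap.mulRight ℝ D ∘ₗ LinearMap.mulLeft ℝ A₁ᵀ
  let r₂ : Matrix (Fin n) (Fin n) ℝ →ₗ[ℝ] Matrix (Fin n) (Fin n) ℝ :=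
    (LinearMap.mulRight ℝ A₁ - LinearMap.mulRight ℝ D ∘ₗ LinearMap.mulLeft ℝ A₀ᵀ) ∘ₗ
      (transposeLinearEquiv (Fin n) (Fin n) ℝ ℝ).toLinearMap
  refine ⟨LinearMap.toContinuousLinearMap (steinEquiv.symm.toLinearMap ∘ₗ r₁),
    LinearMap.toContinuousLinearMap (steinEquiv.symm.toLinearMap ∘ₗ r₂), fun θ hθ => ?_⟩
  have hsolve : mderiv U θ = steinEquiv.symm (r₁ (U θ) + r₂ (U (h - θ))) :=
    (steinEquiv.eq_symm_apply).2 (hU.steinMap_mderiv hθ)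
  rw [map_add] at hsolve
  exact hsolve ▸ hU.hasDerivAt hθ

/-- `V` is a twice continuously differentiable function on the line which coincides with `U` on
`[0, h]`; its derivatives are `V₁` and `V₂`. -/
structure IsC2Extension (h : ℝ) (U V V₁ V₂ : ℝ → Matrix (Fin n) (Fin n) ℝ) : Prop where
  hasDerivAt : ∀ t, HasDerivAt V (V₁ t) t
  hasDerivAt' : ∀ t, HasDerivAt V₁ (V₂ t) t
  continuous₂ : Continuous V₂
  eqOn : EqOn V U (Icc 0 h)

theorem IsDelayLyapunovMatrix.exists_isC2Extension (hh : 0 ≤ h)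
    (hU : IsDelayLyapunovMatrix h A₀ A₁ D W U P) (hD : Function.Injective (steinMap D)) :
    ∃ V V₁ V₂ : ℝ → Matrix (Fin n) (Fin n) ℝ, IsC2Extension h U V V₁ V₂ := by
  obtain ⟨l₁, l₂, hderiv⟩ := hU.exists_hasDerivAt hD
  obtain ⟨V, V₁, V₂, hV, hV', hV₂, hVU⟩ := exists_extension_hasDerivAt_hasDerivAt hh
    (hU.continuousOn.mono (Icc_subset_Icc_left (neg_nonpos.2 hh))) hderiv
  exact ⟨V, V₁, V₂, hV, hV', hV₂, hVU⟩

namespace IsC2Extension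

variable {V V₁ V₂ : ℝ → Matrix (Fin n) (Fin n) ℝ}

theorem continuous (hV : IsC2Extension h U V V₁ V₂) : Continuous V :=
  continuous_iff_continuousAt.2 fun t => (hV.hasDerivAt t).continuousAt

theorem continuous₁ (hV : IsC2Extension h U V V₁ V₂) : Continuous V₁ :=
  continuous_iff_continuousAt.2 fun t => (hV.hasDerivAt' t).continuousAt

theorem mderiv_eq (hV : IsC2Extension h U V V₁ V₂) {θ : ℝ} (hθ : θ ∈ Ioo 0 h) :
    mderiv U θ = V₁ θ := by
  refine mderiv_eq_of_hasDerivAt ((hV.hasDerivAt θ).congr_of_eventuallyEq ?_)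
  filter_upwards [Icc_mem_nhds hθ.1 hθ.2] with s hs using (hV.eqOn hs).symm

theorem mderiv_mderiv_eq (hV : IsC2Extension h U V V₁ V₂) {θ : ℝ} (hθ : θ ∈ Ioo 0 h) :
    mderiv (mderiv U) θ = V₂ θ := by
  refine mderiv_eq_of_hasDerivAt ((hV.hasDerivAt' θ).congr_of_eventuallyEq ?_)
  filter_upwards [Ioo_mem_nhds hθ.1 hθ.2] with s hs using hV.mderiv_eq hs

theorem apply_neg (hV : IsC2Extension h U V V₁ V₂)
    (hU : IsDelayLyapunovMatrix h A₀ A₁ D W U P) {θ : ℝ} (hθ : θ ∈ Icc 0 h) :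
    U (-θ) = (V θ)ᵀ := by
  rw [hU.apply_neg hθ, hV.eqOn hθ]

theorem mderiv_neg (hV : IsC2Extension h U V V₁ V₂)
    (hU : IsDelayLyapunovMatrix h A₀ A₁ D W U P) {θ : ℝ} (hθ : θ ∈ Ioo 0 h) :
    mderiv U (-θ) = -(V₁ θ)ᵀ := by
  rw [hU.mderiv_neg hθ, hV.mderiv_eq hθ]

theorem mderiv_mderiv_neg (hV : IsC2Extension h U V V₁ V₂)
    (hU : IsDelayLyapunovMatrix h A₀ A₁ D W U P) {θ : ℝ} (hθ : θ ∈ Ioo 0 h) :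
    mderiv (mderiv U) (-θ) = (V₂ θ)ᵀ := by
  rw [mderiv_neg_of_eq_transpose (fun s hs => hV.mderiv_neg hU hs) hθ (hV.hasDerivAt' θ).fun_neg]
  simp

theorem transpose_apply_zero (hV : IsC2Extension h U V V₁ V₂)
    (hU : IsDelayLyapunovMatrix h A₀ A₁ D W U P) (hh : 0 ≤ h) : (V 0)ᵀ = V 0 := by
  rw [← hV.apply_neg hU (left_mem_Icc.2 hh), neg_zero, hV.eqOn (left_mem_Icc.2 hh)]

theorem dynamic (hV : IsC2Extension h U V V₁ V₂) (hU : IsDelayLyapunovMatrix h A₀ A₁ D W U P)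
    (hh : 0 < h) {θ : ℝ} (hθ : θ ∈ Icc 0 h) :
    (V₁ θ)ᵀ + Dᵀ * V₁ (h - θ) = A₀ᵀ * (V θ)ᵀ + A₁ᵀ * V (h - θ) := by
  have hV_cont := hV.continuous
  have hV₁_cont := hV.continuous₁
  suffices hIoo : EqOn (fun θ => (V₁ θ)ᵀ + Dᵀ * V₁ (h - θ))
      (fun θ => A₀ᵀ * (V θ)ᵀ + A₁ᵀ * V (h - θ)) (Ioo 0 h) from
    hIoo.closure (by fun_prop) (by fun_prop) (closure_Ioo hh.ne ▸ hθ)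
  intro s hs
  have hs' : h - s ∈ Ioo 0 h := ⟨sub_pos.2 hs.2, sub_lt_self _ hs.1⟩
  simpa only [hV.mderiv_eq hs, hV.mderiv_eq hs', ← hV.eqOn (Ioo_subset_Icc_self hs),
    ← hV.eqOn (Ioo_subset_Icc_self hs')] using hU.transpose_dynamic hs

theorem deriv_dynamic (hV : IsC2Extension h U V V₁ V₂)
    (hU : IsDelayLyapunovMatrix h A₀ A₁ D W U P) (hh : 0 < h) {θ : ℝ} (hθ : θ ∈ Icc 0 h) :
    (V₂ θ)ᵀ - Dᵀ * V₂ (h - θ) = A₀ᵀ * (V₁ θ)ᵀ - A₁ᵀ * V₁ (h - θ) := by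
  have hV₁_cont := hV.continuous₁
  have hV₂_cont := hV.continuous₂
  suffices hIoo : EqOn (fun θ => (V₂ θ)ᵀ - Dᵀ * V₂ (h - θ))
      (fun θ => A₀ᵀ * (V₁ θ)ᵀ - A₁ᵀ * V₁ (h - θ)) (Ioo 0 h) from
    hIoo.closure (by fun_prop) (by fun_prop) (closure_Ioo hh.ne ▸ hθ)
  intro s hs
  have hleft := (hasDerivAt_transpose (hV.hasDerivAt' s)).add (hasDerivAt_linearMap
    (LinearMap.mulLeft ℝ Dᵀ) ((hV.hasDerivAt' (h - s)).comp_const_sub h s))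
  have hright := (hasDerivAt_linearMap (LinearMap.mulLeft ℝ A₀ᵀ)
    (hasDerivAt_transpose (hV.hasDerivAt s))).add (hasDerivAt_linearMap
    (LinearMap.mulLeft ℝ A₁ᵀ) ((hV.hasDerivAt (h - s)).comp_const_sub h s))
  have heq := hleft.unique (hright.congr_of_eventuallyEq (by
    filter_upwards [Icc_mem_nhds hs.1 hs.2] with r hr using hV.dynamic hU hh hr))
  simpa only [LinearMap.mulLeft_apply, mul_neg, ← sub_eq_add_neg] using heq

theorem deriv_zero_add_transpose (hV : IsC2Extension h U V V₁ V₂)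
    (hU : IsDelayLyapunovMatrix h A₀ A₁ D W U P) (hh : 0 < h) : V₁ 0 + (V₁ 0)ᵀ = P := by
  have hV₁_cont := hV.continuous₁
  have hlim : Tendsto (fun θ => V₁ θ + (V₁ θ)ᵀ) (𝓝[>] 0) (𝓝 (V₁ 0 + (V₁ 0)ᵀ)) :=
    (Continuous.tendsto (by fun_prop) 0).mono_left nhdsWithin_le_nhds
  refine tendsto_nhds_unique (hlim.congr' ?_) hU.jump
  filter_upwards [Ioo_mem_nhdsGT hh] with θ hθ
  rw [hV.mderiv_neg hU hθ, hV.mderiv_eq hθ, sub_neg_eq_add]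

end IsC2Extension

end DelayLyapunovMatrix

/-! ## Quadratic functionals with continuous kernels -/

section BoundedConvergence

variable {E : Type*} [NormedAddCommGroup E] [NormedSpace ℝ E] {a c C C₁ C₂ : ℝ}

theorem tendsto_integral_of_norm_le (hac : a ≤ c) {f : ℕ → ℝ → E} {f₀ : ℝ → E}
    (hf : ∀ k, Continuous (f k)) (hC : ∀ k, ∀ s ∈ Icc a c, ‖f k s‖ ≤ C)
    (hlim : ∀ s ∈ Ioo a c, Tendsto (fun k => f k s) atTop (𝓝 (f₀ s))) :
    Tendsto (fun k => ∫ s in a..c, f k s) atTop (𝓝 (∫ s in a..c, f₀ s)) := by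
  refine intervalIntegral.tendsto_integral_filter_of_dominated_convergence (fun _ => C)
    (Eventually.of_forall fun k => (hf k).aestronglyMeasurable)
    (Eventually.of_forall fun k => Eventually.of_forall fun s hs =>
      hC k s (uIcc_of_le hac ▸ uIoc_subset_uIcc hs)) intervalIntegrable_const ?_
  filter_upwards [volume.ae_ne c] with s hsc hs
  rw [uIoc_of_le hac] at hs
  exact hlim s ⟨hs.1, hs.2.lt_of_ne hsc⟩

theorem tendsto_triInt_of_norm_le (hac : a ≤ c) {k₁ k₂ : ℕ → ℝ → ℝ → E} {l₁ l₂ : ℝ → ℝ → E}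
    (h₁ : ∀ m, Continuous (Function.uncurry (k₁ m)))
    (h₂ : ∀ m, Continuous (Function.uncurry (k₂ m)))
    (hC₁ : ∀ m, ∀ s ∈ Icc a c, ∀ r ∈ Icc a c, ‖k₁ m s r‖ ≤ C₁)
    (hC₂ : ∀ m, ∀ s ∈ Icc a c, ∀ r ∈ Icc a c, ‖k₂ m s r‖ ≤ C₂)
    (hlim₁ : ∀ s ∈ Ioo a c, ∀ r ∈ Ioo a c, Tendsto (fun m => k₁ m s r) atTop (𝓝 (l₁ s r)))
    (hlim₂ : ∀ s ∈ Ioo a c, ∀ r ∈ Ioo a c, Tendsto (fun m => k₂ m s r) atTop (𝓝 (l₂ s r))) :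
    Tendsto (fun m => triInt a c (k₁ m) (k₂ m)) atTop (𝓝 (triInt a c l₁ l₂)) := by
  have hinner : ∀ {k : ℝ → ℝ → E} {K s u v : ℝ}, (∀ r ∈ Icc a c, ‖k s r‖ ≤ K) →
      a ≤ u → u ≤ v → v ≤ c → ‖∫ r in u..v, k s r‖ ≤ K * (c - a) := by
    intro k K s u v hK hau huv hvc
    have hK0 : 0 ≤ K := (norm_nonneg _).trans (hK a (left_mem_Icc.2 hac))
    refine (intervalIntegral.norm_integral_le_of_norm_le_const (C := K) fun r hr => ?_).trans ?_
    · rw [uIoc_of_le huv] at hr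
      exact hK r ⟨hau.trans hr.1.le, hr.2.trans hvc⟩
    · rw [abs_of_nonneg (sub_nonneg.2 huv)]
      exact mul_le_mul_of_nonneg_left (by linarith) hK0
  refine tendsto_integral_of_norm_le (C := C₁ * (c - a) + C₂ * (c - a)) hac (fun m => ?_)
    (fun m s hs => ?_) fun s hs => ?_
  · exact (continuous_integral_limits (h₁ m) continuous_const continuous_id continuous_id).add
      (continuous_integral_limits (h₂ m) continuous_id continuous_const continuous_id)
  · exact (norm_add_le _ _).trans (add_le_add (hinner (hC₁ m s hs) le_rfl hs.1 hs.2)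
      (hinner (hC₂ m s hs) hs.1 hs.2 le_rfl))
  · have hs' := Ioo_subset_Icc_self hs
    exact (tendsto_integral_of_norm_le hs'.1 (fun m => (h₁ m).uncurry_left s)
        (fun m r hr => hC₁ m s hs' r ⟨hr.1, hr.2.trans hs'.2⟩)
        fun r hr => hlim₁ s hs r ⟨hr.1, hr.2.trans hs.2⟩).add
      (tendsto_integral_of_norm_le hs'.2 (fun m => (h₂ m).uncurry_left s)
        (fun m r hr => hC₂ m s hs' r ⟨hs'.1.trans hr.1, hr.2⟩)
        fun r hr => hlim₂ s hs r ⟨hs.1.trans hr.1, hr.2⟩)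

end BoundedConvergence

section KernelFunctional

open scoped Matrix.Norms.Elementwise

variable {ι : Type*} [Fintype ι] {h : ℝ} {V₀ R : Matrix ι ι ℝ} {N N' M₁ M₂ : ℝ → Matrix ι ι ℝ}

/-- The form of the Lyapunov-Krasovskii functional when its kernels are continuous: `V₀` is the
matrix of the square of `ξ`, `N` the kernel of the mixed term, `M₁` and `M₂` are the kernels of the
double integral below and above the diagonal, and `R` is the matrix of the single integral. -/
def kernelFunctional (h : ℝ) (V₀ R : Matrix ι ι ℝ) (N M₁ M₂ : ℝ → Matrix ι ι ℝ) (ξ : ι → ℝ)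
    (φ : ℝ → ι → ℝ) : ℝ :=
  ξ ⬝ᵥ V₀ *ᵥ ξ + 2 * (∫ θ in (-h)..0, ξ ⬝ᵥ N (h + θ) *ᵥ φ θ)
    + triInt (-h) 0 (fun a b => φ a ⬝ᵥ M₁ (a - b) *ᵥ φ b) (fun a b => φ a ⬝ᵥ M₂ (b - a) *ᵥ φ b)
    - ∫ θ in (-h)..0, φ θ ⬝ᵥ R *ᵥ φ θ

theorem kernelFunctional_shift (h : ℝ) (V₀ R : Matrix ι ι ℝ) (N M₁ M₂ : ℝ → Matrix ι ι ℝ)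
    (ξ : ι → ℝ) (x : ℝ → ι → ℝ) (t : ℝ) :
    kernelFunctional h V₀ R N M₁ M₂ ξ (fun θ => x (θ + t)) =
      ξ ⬝ᵥ V₀ *ᵥ ξ + 2 * (∫ s in (t - h)..t, ξ ⬝ᵥ N (s - (t - h)) *ᵥ x s)
        + triInt (t - h) t (fun a b => x a ⬝ᵥ M₁ (a - b) *ᵥ x b)
          (fun a b => x a ⬝ᵥ M₂ (b - a) *ᵥ x b)
        - ∫ s in (t - h)..t, x s ⬝ᵥ R *ᵥ x s := by
  have hmixed := intervalIntegral.integral_comp_add_right (a := -h) (b := 0)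
    (fun s => ξ ⬝ᵥ N (s - (t - h)) *ᵥ x s) t
  have hsingle := intervalIntegral.integral_comp_add_right (a := -h) (b := 0)
    (fun s => x s ⬝ᵥ R *ᵥ x s) t
  have hdouble := triInt_comp_add (-h) 0 t (fun a b => x a ⬝ᵥ M₁ (a - b) *ᵥ x b)
    (fun a b => x a ⬝ᵥ M₂ (b - a) *ᵥ x b)
  have harg : ∀ θ, θ + t - (t - h) = h + θ := fun θ => by ring
  simp only [zero_add, neg_add_eq_sub, add_sub_add_right_eq_sub, harg] at hmixed hsingle hdouble
  rw [kernelFunctional, hmixed, hsingle, hdouble]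

theorem kernelFunctional_zero : kernelFunctional h V₀ R N M₁ M₂ 0 0 = 0 := by
  simp [kernelFunctional, triInt]

theorem kernelFunctional_congr (hh : 0 ≤ h) (ξ : ι → ℝ) {φ ψ : ℝ → ι → ℝ}
    (hφψ : EqOn φ ψ (Ioo (-h) 0)) :
    kernelFunctional h V₀ R N M₁ M₂ ξ φ = kernelFunctional h V₀ R N M₁ M₂ ξ ψ := by
  have hle : -h ≤ 0 := neg_nonpos.2 hh
  unfold kernelFunctional
  congr 1
  · congr 1
    · refine congrArg (_ + 2 * ·)
        (intervalIntegral.integral_congr_Ioo_of_le hle fun θ hθ => ?_)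
      simp only [hφψ hθ]
    · refine triInt_congr hle (fun s hs r hr => ?_) fun s hs r hr => ?_
      · simp only [hφψ hs, hφψ ⟨hr.1, hr.2.trans hs.2⟩]
      · simp only [hφψ hs, hφψ ⟨hs.1.trans hr.1, hr.2⟩]
  · refine intervalIntegral.integral_congr_Ioo_of_le hle fun θ hθ => ?_
    simp only [hφψ hθ]

variable {x y y' : ℝ → ι → ℝ}

theorem hasDerivAt_integral_window {E : Type*} [NormedAddCommGroup E] [NormedSpace ℝ E]
    [CompleteSpace E] {f : ℝ → E} (hf : Continuous f) (h t : ℝ) :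
    HasDerivAt (fun t => ∫ s in (t - h)..t, f s) (f t - f (t - h)) t := by
  refine ((hasDerivAt_integral_param (f := fun _ => f) (f' := fun _ _ => 0)
    (hf.comp continuous_snd) continuous_const (fun t s => hasDerivAt_const _ _)
    ((hasDerivAt_id t).sub_const h) (hasDerivAt_id t))).congr_deriv ?_
  simp

theorem hasDerivAt_integral_mixed (hN : ∀ t, HasDerivAt N (N' t) t) (hN' : Continuous N')
    (hx : Continuous x) (hy : ∀ t, HasDerivAt y (y' t) t) (hy' : Continuous y') (h t : ℝ) :
    HasDerivAt (fun t => ∫ s in (t - h)..t, y t ⬝ᵥ N (s - (t - h)) *ᵥ x s)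
      (y t ⬝ᵥ N h *ᵥ x t - y t ⬝ᵥ N 0 *ᵥ x (t - h) + ∫ s in (t - h)..t,
        (y' t ⬝ᵥ N (s - (t - h)) *ᵥ x s - y t ⬝ᵥ N' (s - (t - h)) *ᵥ x s)) t := by
  have hy_cont : Continuous y := continuous_iff_continuousAt.2 fun t => (hy t).continuousAt
  have hN_cont : Continuous N := continuous_iff_continuousAt.2 fun t => (hN t).continuousAt
  have hintegrand : ∀ t s, HasDerivAt (fun t => y t ⬝ᵥ N (s - (t - h)) *ᵥ x s)
      (y' t ⬝ᵥ N (s - (t - h)) *ᵥ x s - y t ⬝ᵥ N' (s - (t - h)) *ᵥ x s) t := fun t s => by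
    have hshift := (hN (s - (t - h))).scomp t (((hasDerivAt_id t).sub_const h).const_sub s)
    refine (hasDerivAt_dotProduct (hy t) (hasDerivAt_mulVec_const hshift (x s))).congr_deriv ?_
    rw [neg_one_smul, neg_mulVec, dotProduct_neg, ← sub_eq_add_neg]
    rfl
  refine (hasDerivAt_integral_param (by simp only [Function.uncurry_def]; fun_prop)
    (by simp only [Function.uncurry_def]; fun_prop) hintegrand ((hasDerivAt_id t).sub_const h)
    (hasDerivAt_id t)).congr_deriv ?_
  simp

theorem hasDerivAt_kernelFunctional (hN : ∀ t, HasDerivAt N (N' t) t) (hN' : Continuous N')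
    (h₁ : Continuous M₁) (h₂ : Continuous M₂) (hx : Continuous x)
    (hy : ∀ t, HasDerivAt y (y' t) t) (hy' : Continuous y') (t : ℝ) :
    HasDerivAt (fun t => kernelFunctional h V₀ R N M₁ M₂ (y t) (fun θ => x (θ + t)))
      (y' t ⬝ᵥ V₀ *ᵥ y t + y t ⬝ᵥ V₀ *ᵥ y' t
        + 2 * (y t ⬝ᵥ N h *ᵥ x t - y t ⬝ᵥ N 0 *ᵥ x (t - h))
        - (x t ⬝ᵥ R *ᵥ x t - x (t - h) ⬝ᵥ R *ᵥ x (t - h))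
        + ∫ s in (t - h)..t, (2 * (y' t ⬝ᵥ N (s - (t - h)) *ᵥ x s
              - y t ⬝ᵥ N' (s - (t - h)) *ᵥ x s)
            + (x t ⬝ᵥ M₁ (t - s) *ᵥ x s - x (t - h) ⬝ᵥ M₂ (s - (t - h)) *ᵥ x s)
            + (x s ⬝ᵥ M₂ (t - s) *ᵥ x t - x s ⬝ᵥ M₁ (s - (t - h)) *ᵥ x (t - h)))) t := by
  have hN_cont : Continuous N := continuous_iff_continuousAt.2 fun t => (hN t).continuousAt
  have hsquare := hasDerivAt_dotProduct (hy t)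
    ((mulVecCLM V₀).hasFDerivAt.comp_hasDerivAt t (hy t))
  have hdouble := hasDerivAt_triInt (k₁ := fun a b => x a ⬝ᵥ M₁ (a - b) *ᵥ x b)
    (k₂ := fun a b => x a ⬝ᵥ M₂ (b - a) *ᵥ x b)
    (by simp only [Function.uncurry_def]; fun_prop)
    (by simp only [Function.uncurry_def]; fun_prop) h t
  have hsingle := hasDerivAt_integral_window (f := fun s => x s ⬝ᵥ R *ᵥ x s) (by fun_prop) h t
  simp only [kernelFunctional_shift]
  refine (((hsquare.add ((hasDerivAt_integral_mixed hN hN' hx hy hy' h t).const_mul 2)).add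
    hdouble).sub hsingle).congr_deriv ?_
  rw [intervalIntegral.integral_add (Continuous.intervalIntegrable (by fun_prop) _ _)
      (Continuous.intervalIntegrable (by fun_prop) _ _),
    intervalIntegral.integral_add (Continuous.intervalIntegrable (by fun_prop) _ _)
      (Continuous.intervalIntegrable (by fun_prop) _ _),
    intervalIntegral.integral_const_mul,
    intervalIntegral.integral_sub (f := fun s => x t ⬝ᵥ M₁ (t - s) *ᵥ x s)
      (Continuous.intervalIntegrable (by fun_prop) _ _)
      (Continuous.intervalIntegrable (by fun_prop) _ _)]
  simp only [Function.comp_apply, mulVecCLM_apply]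
  ring

theorem exists_norm_dotProduct_mulVec_le {M : ℝ → Matrix ι ι ℝ} (hM : Continuous M) (B h : ℝ) :
    ∃ C : ℝ, ∀ ⦃u v : ι → ℝ⦄ ⦃r : ℝ⦄, ‖u‖ ≤ B → ‖v‖ ≤ B → r ∈ Icc (-h) h →
      ‖u ⬝ᵥ M r *ᵥ v‖ ≤ C := by
  obtain ⟨C, hC⟩ := ((isCompact_closedBall (0 : ι → ℝ) B).prod
    ((isCompact_closedBall (0 : ι → ℝ) B).prod
      (isCompact_Icc (a := -h) (b := h)))).exists_bound_of_continuousOn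
    (f := fun p => p.1 ⬝ᵥ M p.2.2 *ᵥ p.2.1) (Continuous.continuousOn (by fun_prop))
  exact ⟨C, fun u v r hu hv hr =>
    hC (u, v, r) ⟨mem_closedBall_zero_iff.2 hu, mem_closedBall_zero_iff.2 hv, hr⟩⟩

theorem tendsto_dotProduct_mulVec {α : Type*} {l : Filter α} {u v : α → ι → ℝ} {u₀ v₀ : ι → ℝ}
    (hu : Tendsto u l (𝓝 u₀)) (hv : Tendsto v l (𝓝 v₀)) (M : Matrix ι ι ℝ) :
    Tendsto (fun k => u k ⬝ᵥ M *ᵥ v k) l (𝓝 (u₀ ⬝ᵥ M *ᵥ v₀)) :=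
  (Continuous.tendsto (f := fun p : (ι → ℝ) × (ι → ℝ) => p.1 ⬝ᵥ M *ᵥ p.2) (by fun_prop)
    (u₀, v₀)).comp (hu.prodMk_nhds hv)

theorem tendsto_kernelFunctional (hh : 0 ≤ h) (hN : Continuous N) (h₁ : Continuous M₁)
    (h₂ : Continuous M₂) {ξ : ℕ → ι → ℝ} {ξ₀ : ι → ℝ} {φ : ℕ → ℝ → ι → ℝ} {φ₀ : ℝ → ι → ℝ}
    {B : ℝ} (hξ : Tendsto ξ atTop (𝓝 ξ₀)) (hξB : ∀ k, ‖ξ k‖ ≤ B) (hφ_cont : ∀ k, Continuous (φ k))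
    (hφB : ∀ k, ∀ θ ∈ Icc (-h) 0, ‖φ k θ‖ ≤ B)
    (hφ : ∀ θ ∈ Ioo (-h) 0, Tendsto (fun k => φ k θ) atTop (𝓝 (φ₀ θ))) :
    Tendsto (fun k => kernelFunctional h V₀ R N M₁ M₂ (ξ k) (φ k)) atTop
      (𝓝 (kernelFunctional h V₀ R N M₁ M₂ ξ₀ φ₀)) := by
  have hle : -h ≤ 0 := neg_nonpos.2 hh
  obtain ⟨CN, hCN⟩ := exists_norm_dotProduct_mulVec_le hN B h
  obtain ⟨CR, hCR⟩ := exists_norm_dotProduct_mulVec_le (continuous_const (y := R)) B h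
  obtain ⟨C₁, hC₁⟩ := exists_norm_dotProduct_mulVec_le h₁ B h
  obtain ⟨C₂, hC₂⟩ := exists_norm_dotProduct_mulVec_le h₂ B h
  have hmixed := tendsto_integral_of_norm_le hle
    (f := fun k θ => ξ k ⬝ᵥ N (h + θ) *ᵥ φ k θ) (fun k => by have := hφ_cont k; fun_prop)
    (fun k θ hθ => hCN (hξB k) (hφB k θ hθ) ⟨by linarith [hθ.1], by linarith [hθ.2]⟩)
    fun θ hθ => tendsto_dotProduct_mulVec hξ (hφ θ hθ) _
  have hsingle := tendsto_integral_of_norm_le hle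
    (f := fun k θ => φ k θ ⬝ᵥ R *ᵥ φ k θ) (fun k => by have := hφ_cont k; fun_prop)
    (fun k θ hθ => hCR (hφB k θ hθ) (hφB k θ hθ) ⟨hle, hh⟩)
    fun θ hθ => tendsto_dotProduct_mulVec (hφ θ hθ) (hφ θ hθ) _
  have hdouble := tendsto_triInt_of_norm_le hle
    (k₁ := fun k a b => φ k a ⬝ᵥ M₁ (a - b) *ᵥ φ k b)
    (k₂ := fun k a b => φ k a ⬝ᵥ M₂ (b - a) *ᵥ φ k b)
    (fun k => by have := hφ_cont k; simp only [Function.uncurry_def]; fun_prop)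
    (fun k => by have := hφ_cont k; simp only [Function.uncurry_def]; fun_prop)
    (fun k s hs r hr => hC₁ (hφB k s hs) (hφB k r hr)
      ⟨by linarith [hs.1, hr.2], by linarith [hs.2, hr.1]⟩)
    (fun k s hs r hr => hC₂ (hφB k s hs) (hφB k r hr)
      ⟨by linarith [hs.2, hr.1], by linarith [hs.1, hr.2]⟩)
    (fun s hs r hr => tendsto_dotProduct_mulVec (hφ s hs) (hφ r hr) _)
    (fun s hs r hr => tendsto_dotProduct_mulVec (hφ s hs) (hφ r hr) _)
  exact (((tendsto_dotProduct_mulVec hξ hξ V₀).add (hmixed.const_mul 2)).add hdouble).sub hsingle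

end KernelFunctional

section Dissipation

open scoped Matrix.Norms.Elementwise

variable {n : ℕ}

theorem mulVec_dotProduct_mulVec {l m k : Type*} [Fintype l] [Fintype m] [Fintype k]
    (A : Matrix m k ℝ) (M : Matrix m l ℝ) (u : k → ℝ) (v : l → ℝ) :
    (A *ᵥ u) ⬝ᵥ M *ᵥ v = u ⬝ᵥ (Aᵀ * M) *ᵥ v := by
  rw [← mulVec_mulVec, dotProduct_mulVec u, vecMul_transpose]

section Kernels

variable (A₁ D : Matrix (Fin n) (Fin n) ℝ) (V V₁ V₂ : ℝ → Matrix (Fin n) (Fin n) ℝ)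

/-- The kernel of the mixed term of the functional, in terms of the Lyapunov matrix and its
derivative. -/
def mixedKernel (r : ℝ) : Matrix (Fin n) (Fin n) ℝ := (V r)ᵀ * A₁ - (V₁ r)ᵀ * D

/-- The kernel of the double integral of the functional below the diagonal, as a function of
`r = θ₁ - θ₂ > 0`. -/
def lowerKernel (r : ℝ) : Matrix (Fin n) (Fin n) ℝ :=
  A₁ᵀ * V r * A₁ + (2 : ℝ) • (A₁ᵀ * V₁ r * D) - Dᵀ * V₂ r * D

/-- The kernel of the double integral of the functional above the diagonal, as a function of
`r = θ₂ - θ₁ > 0`: there `U(-r) = U(r)ᵀ`, `U'(-r) = -U'(r)ᵀ` and `U''(-r) = U''(r)ᵀ`. -/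
def upperKernel (r : ℝ) : Matrix (Fin n) (Fin n) ℝ :=
  A₁ᵀ * (V r)ᵀ * A₁ - (2 : ℝ) • (A₁ᵀ * (V₁ r)ᵀ * D) - Dᵀ * (V₂ r)ᵀ * D

/-- The Lyapunov-Krasovskii functional written with a twice continuously differentiable extension
`V` of the delay Lyapunov matrix from `[0, h]`, so that its kernels are continuous. -/
def lyapunovFunctional (h : ℝ) (P : Matrix (Fin n) (Fin n) ℝ) (ξ : Fin n → ℝ)
    (φ : ℝ → Fin n → ℝ) : ℝ :=
  kernelFunctional h (V 0) (Dᵀ * P * D) (mixedKernel A₁ D V V₁) (lowerKernel A₁ D V V₁ V₂)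
    (upperKernel A₁ D V V₁ V₂) ξ φ

end Kernels

variable {h : ℝ} {A₀ A₁ D W P : Matrix (Fin n) (Fin n) ℝ}
  {U V V₁ V₂ : ℝ → Matrix (Fin n) (Fin n) ℝ}

namespace IsC2Extension

theorem hasDerivAt_mixedKernel (hV : IsC2Extension h U V V₁ V₂)
    (A₁ D : Matrix (Fin n) (Fin n) ℝ) (t : ℝ) :
    HasDerivAt (mixedKernel A₁ D V V₁) (mixedKernel A₁ D V₁ V₂ t) t :=
  (hasDerivAt_linearMap (LinearMap.mulRight ℝ A₁) (hasDerivAt_transpose (hV.hasDerivAt t))).sub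
    (hasDerivAt_linearMap (LinearMap.mulRight ℝ D) (hasDerivAt_transpose (hV.hasDerivAt' t)))

theorem continuous_mixedKernel (hV : IsC2Extension h U V V₁ V₂)
    (A₁ D : Matrix (Fin n) (Fin n) ℝ) : Continuous (mixedKernel A₁ D V V₁) :=
  continuous_iff_continuousAt.2 fun t => (hV.hasDerivAt_mixedKernel A₁ D t).continuousAt

theorem continuous_mixedKernel_deriv (hV : IsC2Extension h U V V₁ V₂)
    (A₁ D : Matrix (Fin n) (Fin n) ℝ) : Continuous (mixedKernel A₁ D V₁ V₂) := by
  have hV₁_cont := hV.continuous₁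
  have hV₂_cont := hV.continuous₂
  unfold mixedKernel
  fun_prop

theorem continuous_lowerKernel (hV : IsC2Extension h U V V₁ V₂)
    (A₁ D : Matrix (Fin n) (Fin n) ℝ) : Continuous (lowerKernel A₁ D V V₁ V₂) := by
  have hV_cont := hV.continuous
  have hV₁_cont := hV.continuous₁
  have hV₂_cont := hV.continuous₂
  unfold lowerKernel
  fun_prop

theorem continuous_upperKernel (hV : IsC2Extension h U V V₁ V₂)
    (A₁ D : Matrix (Fin n) (Fin n) ℝ) : Continuous (upperKernel A₁ D V V₁ V₂) := by
  have hV_cont := hV.continuous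
  have hV₁_cont := hV.continuous₁
  have hV₂_cont := hV.continuous₂
  unfold upperKernel
  fun_prop

theorem deriv_mixedKernel_eq (hV : IsC2Extension h U V V₁ V₂)
    (hU : IsDelayLyapunovMatrix h A₀ A₁ D W U P) (hh : 0 < h) {θ : ℝ} (hθ : θ ∈ Icc 0 h) :
    (2 : ℝ) • mixedKernel A₁ D V₁ V₂ θ = (2 : ℝ) • (A₀ᵀ * mixedKernel A₁ D V V₁ θ)
      + (lowerKernel A₁ D V V₁ V₂ (h - θ) + (upperKernel A₁ D V V₁ V₂ (h - θ))ᵀ) := by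
  have hV₁θ : (V₁ θ)ᵀ = A₀ᵀ * (V θ)ᵀ + A₁ᵀ * V (h - θ) - Dᵀ * V₁ (h - θ) :=
    eq_sub_of_add_eq (hV.dynamic hU hh hθ)
  have hV₂θ : (V₂ θ)ᵀ = A₀ᵀ * (V₁ θ)ᵀ - A₁ᵀ * V₁ (h - θ) + Dᵀ * V₂ (h - θ) :=
    eq_add_of_sub_eq (hV.deriv_dynamic hU hh hθ)
  have hderiv : mixedKernel A₁ D V₁ V₂ θ = A₀ᵀ * mixedKernel A₁ D V V₁ θ
      + (A₁ᵀ * V (h - θ) * A₁ - Dᵀ * V₁ (h - θ) * A₁ + A₁ᵀ * V₁ (h - θ) * D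
        - Dᵀ * V₂ (h - θ) * D) := by
    rw [mixedKernel, mixedKernel, hV₂θ]
    nth_rewrite 1 [hV₁θ]
    noncomm_ring
  rw [hderiv]
  simp only [lowerKernel, upperKernel, transpose_sub, transpose_add, transpose_mul,
    transpose_transpose, two_smul]
  noncomm_ring

end IsC2Extension

theorem upperKernel_add_transpose_lowerKernel (A₁ D : Matrix (Fin n) (Fin n) ℝ)
    (V V₁ V₂ : ℝ → Matrix (Fin n) (Fin n) ℝ) (θ : ℝ) :
    upperKernel A₁ D V V₁ V₂ θ + (lowerKernel A₁ D V V₁ V₂ θ)ᵀ =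
      (2 : ℝ) • (A₁ᵀ * mixedKernel A₁ D V V₁ θ + Dᵀ * mixedKernel A₁ D V₁ V₂ θ) := by
  simp only [mixedKernel, lowerKernel, upperKernel, transpose_sub, transpose_add, transpose_mul,
    transpose_transpose, two_smul]
  noncomm_ring

namespace IsC2Extension

/-- The integrand in the derivative of the functional along a solution, with `z = y(t)`,
`p = x(t - h)` and `u = x(s)`. -/
theorem integrand_eq_zero (hV : IsC2Extension h U V V₁ V₂)
    (hU : IsDelayLyapunovMatrix h A₀ A₁ D W U P) (hh : 0 < h) {θ : ℝ} (hθ : θ ∈ Icc 0 h)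
    (z p u : Fin n → ℝ) :
    2 * ((A₀ *ᵥ (z + D *ᵥ p) + A₁ *ᵥ p) ⬝ᵥ mixedKernel A₁ D V V₁ θ *ᵥ u
        - z ⬝ᵥ mixedKernel A₁ D V₁ V₂ θ *ᵥ u)
      + ((z + D *ᵥ p) ⬝ᵥ lowerKernel A₁ D V V₁ V₂ (h - θ) *ᵥ u
        - p ⬝ᵥ upperKernel A₁ D V V₁ V₂ θ *ᵥ u)
      + (u ⬝ᵥ upperKernel A₁ D V V₁ V₂ (h - θ) *ᵥ (z + D *ᵥ p)
        - u ⬝ᵥ lowerKernel A₁ D V V₁ V₂ θ *ᵥ p) = 0 := by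
  have hpresent := congrArg (fun M => (z + D *ᵥ p) ⬝ᵥ M *ᵥ u) (hV.deriv_mixedKernel_eq hU hh hθ)
  have hdelayed := congrArg (fun M => p ⬝ᵥ M *ᵥ u)
    (upperKernel_add_transpose_lowerKernel A₁ D V V₁ V₂ θ)
  simp only [add_mulVec, smul_mulVec, dotProduct_add, dotProduct_smul, smul_eq_mul,
    ← mulVec_dotProduct_mulVec, dotProduct_transpose_mulVec] at hpresent hdelayed
  simp only [add_dotProduct] at hpresent ⊢
  linear_combination -hpresent - hdelayed

theorem mixedKernel_apply_delay (hV : IsC2Extension h U V V₁ V₂)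
    (hU : IsDelayLyapunovMatrix h A₀ A₁ D W U P) (hh : 0 < h) :
    mixedKernel A₁ D V V₁ h = V₁ 0 - V 0 * A₀ := by
  have hdyn := congrArg transpose (hV.dynamic hU hh (left_mem_Icc.2 hh.le))
  simp only [sub_zero, transpose_add, transpose_mul, transpose_transpose] at hdyn
  rw [mixedKernel, sub_eq_sub_iff_add_eq_add, hdyn, add_comm]

theorem mixedKernel_apply_zero (hV : IsC2Extension h U V V₁ V₂)
    (hU : IsDelayLyapunovMatrix h A₀ A₁ D W U P) (hh : 0 ≤ h) :
    mixedKernel A₁ D V V₁ 0 = V 0 * A₁ - (V₁ 0)ᵀ * D := by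
  rw [mixedKernel, hV.transpose_apply_zero hU hh]

/-- The terms outside the integral in the derivative of the functional along a solution, with
`z = y(t)` and `p = x(t - h)`. -/
theorem boundary_eq (hV : IsC2Extension h U V V₁ V₂) (hU : IsDelayLyapunovMatrix h A₀ A₁ D W U P)
    (hh : 0 < h) (z p : Fin n → ℝ) :
    (A₀ *ᵥ (z + D *ᵥ p) + A₁ *ᵥ p) ⬝ᵥ V 0 *ᵥ z + z ⬝ᵥ V 0 *ᵥ (A₀ *ᵥ (z + D *ᵥ p) + A₁ *ᵥ p)
      + 2 * (z ⬝ᵥ mixedKernel A₁ D V V₁ h *ᵥ (z + D *ᵥ p) - z ⬝ᵥ mixedKernel A₁ D V V₁ 0 *ᵥ p)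
      - ((z + D *ᵥ p) ⬝ᵥ (Dᵀ * P * D) *ᵥ (z + D *ᵥ p) - p ⬝ᵥ (Dᵀ * P * D) *ᵥ p)
      = -((z + D *ᵥ p) ⬝ᵥ W *ᵥ (z + D *ᵥ p)) := by
  have hW : Dᵀ * P * D = P + W := by
    rw [← sub_eq_iff_eq_add', ← neg_sub, hU.algebraic, neg_neg]
  have hsymm : ∀ u v, u ⬝ᵥ V 0 *ᵥ v = v ⬝ᵥ V 0 *ᵥ u := fun u v => by
    rw [← dotProduct_transpose_mulVec, hV.transpose_apply_zero hU hh.le]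
  have hP : ∀ u v, u ⬝ᵥ P *ᵥ v = u ⬝ᵥ V₁ 0 *ᵥ v + v ⬝ᵥ V₁ 0 *ᵥ u := fun u v => by
    rw [← hV.deriv_zero_add_transpose hU hh, add_mulVec, dotProduct_add,
      dotProduct_transpose_mulVec]
  have hdelayed : p ⬝ᵥ (Dᵀ * P * D) *ᵥ p = (D *ᵥ p) ⬝ᵥ P *ᵥ (D *ᵥ p) := by
    rw [mulVec_dotProduct_mulVec, mulVec_mulVec]
  rw [hdelayed, hW, hV.mixedKernel_apply_delay hU hh, hV.mixedKernel_apply_zero hU hh.le,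
    hsymm _ z]
  simp only [sub_mulVec, add_mulVec, dotProduct_sub, dotProduct_add, ← mulVec_mulVec,
    dotProduct_transpose_mulVec, hP, mulVec_add, add_dotProduct]
  ring

end IsC2Extension

theorem IsC2Extension.hasDerivAt_lyapunovFunctional (hV : IsC2Extension h U V V₁ V₂)
    (hU : IsDelayLyapunovMatrix h A₀ A₁ D W U P) (hh : 0 < h) {φ x y : ℝ → Fin n → ℝ}
    (hx : IsContinuousSolution h (mulVecCLM A₀) (mulVecCLM A₁) (mulVecCLM D) φ x y) {t : ℝ}
    (ht : 0 ≤ t) :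
    HasDerivAt (fun t => lyapunovFunctional A₁ D V V₁ V₂ h P (y t) fun θ => x (θ + t))
      (-(x t ⬝ᵥ W *ᵥ x t)) t := by
  have hx_cont := hx.continuous
  have hy_cont : Continuous y :=
    continuous_iff_continuousAt.2 fun t => (hx.hasDerivAt t).continuousAt
  refine (hasDerivAt_kernelFunctional (hV.hasDerivAt_mixedKernel A₁ D)
    (hV.continuous_mixedKernel_deriv A₁ D) (hV.continuous_lowerKernel A₁ D)
    (hV.continuous_upperKernel A₁ D) hx_cont hx.hasDerivAt (by fun_prop) t).congr_deriv ?_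
  simp only [mulVecCLM_apply]
  rw [hx.eq_add t ht, mulVecCLM_apply, hV.boundary_eq hU hh,
    intervalIntegral.integral_congr (g := fun _ => 0), intervalIntegral.integral_zero, add_zero]
  intro s hs
  rw [uIcc_of_le (by linarith)] at hs
  have hzero := hV.integrand_eq_zero hU hh (θ := s - (t - h))
    ⟨by linarith [hs.1], by linarith [hs.2]⟩ (y t) (x (t - h)) (x s)
  rwa [show h - (s - (t - h)) = t - s by ring] at hzero

theorem IsC2Extension.tendsto_lyapunovFunctional (hV : IsC2Extension h U V V₁ V₂) (hh : 0 ≤ h)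
    (A₁ D P : Matrix (Fin n) (Fin n) ℝ) {x y : ℝ → Fin n → ℝ} {B : ℝ} (hx : Continuous x)
    (hxB : ∀ t, -h ≤ t → ‖x t‖ ≤ B) (hxlim : Tendsto x atTop (𝓝 0))
    (hyx : ∀ t, 0 ≤ t → y t = x t - D *ᵥ x (t - h)) :
    Tendsto (fun k : ℕ => lyapunovFunctional A₁ D V V₁ V₂ h P (y k) fun θ => x (θ + k)) atTop
      (𝓝 0) := by
  have hB : 0 ≤ B := (norm_nonneg _).trans (hxB 0 (neg_nonpos.2 hh))
  have hyB : ∀ k : ℕ, ‖y k‖ ≤ B + ‖mulVecCLM D‖ * B := fun k => by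
    have hk : (0 : ℝ) ≤ k := k.cast_nonneg
    rw [hyx k hk]
    exact norm_sub_le_of_le (hxB _ (by linarith))
      ((mulVecCLM D).le_opNorm_of_le (hxB _ (by linarith)))
  have hylim : Tendsto (fun k : ℕ => y k) atTop (𝓝 0) := by
    have hdiff : Tendsto (fun t => x t - mulVecCLM D (x (t - h))) atTop (𝓝 0) := by
      simpa [sub_eq_add_neg] using hxlim.sub (((mulVecCLM D).continuous.tendsto 0).comp
        (hxlim.comp (tendsto_atTop_add_const_right _ (-h) tendsto_id)))
    exact (hdiff.comp tendsto_natCast_atTop_atTop).congr fun k => (hyx k k.cast_nonneg).symm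
  have hlim := tendsto_kernelFunctional hh (V₀ := V 0) (R := Dᵀ * P * D)
    (hV.continuous_mixedKernel A₁ D) (hV.continuous_lowerKernel A₁ D)
    (hV.continuous_upperKernel A₁ D) hylim hyB (φ := fun k θ => x (θ + k)) (φ₀ := 0)
    (fun k => hx.comp (continuous_add_const _))
    (fun k θ hθ => (hxB _ (by linarith [hθ.1, k.cast_nonneg (α := ℝ)])).trans
      (le_add_of_nonneg_right (by positivity)))
    fun θ _ => hxlim.comp (tendsto_atTop_add_const_left _ θ tendsto_natCast_atTop_atTop)
  rwa [kernelFunctional_zero] at hlim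

/-- The functional is the integral of `xᵀ W x` over `[0, ∞)` along the solution. -/
theorem IsC2Extension.lyapunovFunctional_nonneg_of_solution (hV : IsC2Extension h U V V₁ V₂)
    (hU : IsDelayLyapunovMatrix h A₀ A₁ D W U P) (hh : 0 < h) (hW : W.PosSemidef)
    (hs : ExpStable h A₀ A₁ D) {φ : ℝ → Fin n → ℝ} (hφ : ContDiff ℝ 1 φ) :
    0 ≤ lyapunovFunctional A₁ D V V₁ V₂ h P (φ 0 - D *ᵥ φ (-h)) φ := by
  obtain ⟨x, y, hx⟩ := exists_isContinuousSolution hh (mulVecCLM A₀) (mulVecCLM A₁) (mulVecCLM D)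
    hφ.continuous
  obtain ⟨γ, hγ, σ, hσ, hdecay⟩ := hs.exists_hasExpDecay hh.le
  obtain ⟨B, hB⟩ := isCompact_Icc.exists_bound_of_continuousOn (s := Icc (-h) 0)
    hφ.continuous.continuousOn
  have hyx : ∀ t, 0 ≤ t → y t = x t - D *ᵥ x (t - h) := fun t ht => (hx.sub_eq ht).symm
  set F : ℝ → ℝ := fun t => lyapunovFunctional A₁ D V V₁ V₂ h P (y t) fun θ => x (θ + t) with hF
  have hderiv : ∀ t, 0 ≤ t → HasDerivAt F (-(x t ⬝ᵥ W *ᵥ x t)) t := fun t ht =>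
    hV.hasDerivAt_lyapunovFunctional hU hh hx ht
  have hanti : AntitoneOn F (Ici 0) := by
    refine antitoneOn_of_hasDerivWithinAt_nonpos (convex_Ici 0)
      (fun t ht => (hderiv t ht).continuousAt.continuousWithinAt)
      (fun t ht => (hderiv t (interior_subset ht)).hasDerivWithinAt) fun t _ => ?_
    simpa using hW.dotProduct_mulVec_nonneg (x t)
  have hlim : Tendsto (fun k : ℕ => F k) atTop (𝓝 0) :=
    hV.tendsto_lyapunovFunctional hh.le A₁ D P hx.continuous
      (fun t ht => hdecay.norm_le hh.le hγ hσ.le hφ hx hB ht) (hdecay.tendsto_zero hσ hφ hx hB) hyx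
  have hF₀ : 0 ≤ F 0 := le_of_tendsto' hlim fun k =>
    hanti self_mem_Ici (mem_Ici.2 k.cast_nonneg) k.cast_nonneg
  have hwindow : F 0 = lyapunovFunctional A₁ D V V₁ V₂ h P (φ 0 - D *ᵥ φ (-h)) φ := by
    simp only [hF, add_zero, hyx 0 le_rfl, zero_sub, hx.initial 0 le_rfl,
      hx.initial (-h) (neg_nonpos.2 hh.le)]
    exact kernelFunctional_congr hh.le _ fun θ hθ => hx.initial θ hθ.2.le
  exact hwindow ▸ hF₀

/-- The initial functions `φ + (1 + θ/h)^(m+1) a` agree with `φ` at `-h` and converge to `φ`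
on `(-h, 0)`, while their values at `0` can be prescribed. -/
theorem IsC2Extension.lyapunovFunctional_nonneg (hV : IsC2Extension h U V V₁ V₂)
    (hU : IsDelayLyapunovMatrix h A₀ A₁ D W U P) (hh : 0 < h) (hW : W.PosSemidef)
    (hs : ExpStable h A₀ A₁ D) (ξ : Fin n → ℝ) {φ : ℝ → Fin n → ℝ} (hφ : ContDiff ℝ 1 φ) :
    0 ≤ lyapunovFunctional A₁ D V V₁ V₂ h P ξ φ := by
  set a : Fin n → ℝ := ξ + D *ᵥ φ (-h) - φ 0 with ha
  let ψ : ℕ → ℝ → Fin n → ℝ := fun m θ => φ θ + (1 + θ / h) ^ (m + 1) • a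
  have hψ : ∀ m, ContDiff ℝ 1 (ψ m) := fun m => by fun_prop
  have hψξ : ∀ m, ψ m 0 - D *ᵥ ψ m (-h) = ξ := fun m => by
    simp [ψ, ha, hh.ne']
  obtain ⟨B, hB⟩ := isCompact_Icc.exists_bound_of_continuousOn (s := Icc (-h) 0)
    hφ.continuous.continuousOn
  have hweight : ∀ θ ∈ Icc (-h) 0, 1 + θ / h ∈ Icc (0 : ℝ) 1 := fun θ hθ => by
    have hlow : -1 ≤ θ / h := (le_div_iff₀ hh).2 (by linarith [hθ.1])
    exact ⟨by linarith, by linarith [div_nonpos_of_nonpos_of_nonneg hθ.2 hh.le]⟩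
  have hψB : ∀ m, ∀ θ ∈ Icc (-h) 0, ‖ψ m θ‖ ≤ max ‖ξ‖ (B + ‖a‖) := fun m θ hθ => by
    obtain ⟨hnonneg, hle⟩ := hweight θ hθ
    refine le_max_of_le_right (norm_add_le_of_le (hB θ hθ) ?_)
    rw [norm_smul, Real.norm_of_nonneg (pow_nonneg hnonneg _)]
    exact mul_le_of_le_one_left (norm_nonneg _) (pow_le_one₀ hnonneg hle)
  have hψlim : ∀ θ ∈ Ioo (-h) 0, Tendsto (fun m => ψ m θ) atTop (𝓝 (φ θ)) := fun θ hθ => by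
    have hlt : 1 + θ / h < 1 := by linarith [div_neg_of_neg_of_pos hθ.2 hh]
    have hpow := (tendsto_pow_atTop_nhds_zero_of_lt_one (hweight θ (Ioo_subset_Icc_self hθ)).1
      hlt).comp (tendsto_add_atTop_nat 1)
    simpa using (hpow.smul_const a).const_add (φ θ)
  refine ge_of_tendsto' (tendsto_kernelFunctional hh.le (hV.continuous_mixedKernel A₁ D)
    (hV.continuous_lowerKernel A₁ D) (hV.continuous_upperKernel A₁ D) tendsto_const_nhds
    (fun _ => le_max_left _ _) (fun m => (hψ m).continuous) hψB hψlim) fun m => ?_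
  have hnonneg := hV.lyapunovFunctional_nonneg_of_solution hU hh hW hs (hψ m)
  rwa [hψξ m] at hnonneg

end Dissipation

/-! ## The quadratic form of the functional -/

section EntrywiseIntegrals

open scoped Matrix.Norms.Elementwise

variable {m l : Type*} [Fintype m] [Fintype l]

theorem dotProduct_integral {f : ℝ → m → ℝ} (ξ : m → ℝ) {a b : ℝ}
    (hf : IntervalIntegrable f volume a b) :
    ξ ⬝ᵥ ∫ θ in a..b, f θ = ∫ θ in a..b, ξ ⬝ᵥ f θ :=
  ((LinearMap.toContinuousLinearMap (dotProductBilin ℝ ℝ ξ)).intervalIntegral_comp_comm hf).symm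

/-- The linear functional `M ↦ u ⬝ᵥ M *ᵥ v` on matrices, in the bundled form in which it commutes
with integrals. -/
def dotProductMulVecCLM (u : m → ℝ) (v : l → ℝ) : Matrix m l ℝ →L[ℝ] ℝ :=
  LinearMap.toContinuousLinearMap (dotProductBilin ℝ ℝ u ∘ₗ (mulVecBilin ℝ ℝ).flip v)

theorem of_integral {M : ℝ → Matrix m l ℝ} (hM : Continuous M) (a b : ℝ) :
    (Matrix.of fun i j => ∫ θ in a..b, M θ i j) = ∫ θ in a..b, M θ :=
  Matrix.ext fun i j => (LinearMap.toContinuousLinearMap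
    (entryLinearMap ℝ ℝ i j)).intervalIntegral_comp_comm (hM.intervalIntegrable a b)

theorem dotProduct_integral_mulVec {M : ℝ → Matrix m l ℝ} (hM : Continuous M) (u : m → ℝ)
    (v : l → ℝ) (a b : ℝ) :
    u ⬝ᵥ (Matrix.of fun i j => ∫ θ in a..b, M θ i j) *ᵥ v = ∫ θ in a..b, u ⬝ᵥ M θ *ᵥ v := by
  rw [of_integral hM]
  exact ((dotProductMulVecCLM u v).intervalIntegral_comp_comm (hM.intervalIntegrable a b)).symm

theorem dotProduct_triInt_mulVec {K₁ K₂ : ℝ → ℝ → Matrix m l ℝ}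
    (h₁ : Continuous (Function.uncurry K₁)) (h₂ : Continuous (Function.uncurry K₂)) (u : m → ℝ)
    (v : l → ℝ) (a c : ℝ) :
    u ⬝ᵥ (Matrix.of fun i j => triInt a c (fun s r => K₁ s r i j) fun s r => K₂ s r i j) *ᵥ v =
      triInt a c (fun s r => u ⬝ᵥ K₁ s r *ᵥ v) (fun s r => u ⬝ᵥ K₂ s r *ᵥ v) := by
  have hentry : (Matrix.of fun i j => triInt a c (fun s r => K₁ s r i j) fun s r => K₂ s r i j) =
      triInt a c K₁ K₂ := Matrix.ext fun i j =>
    (map_triInt (LinearMap.toContinuousLinearMap (entryLinearMap ℝ ℝ i j)) h₁ h₂ a c).symm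
  rw [hentry]
  exact map_triInt (dotProductMulVecCLM u v) h₁ h₂ a c

end EntrywiseIntegrals

section QuadraticForm

open scoped Matrix.Norms.Elementwise

variable {n N : ℕ} {h : ℝ} {A₀ A₁ D W P : Matrix (Fin n) (Fin n) ℝ}
  {U V V₁ V₂ : ℝ → Matrix (Fin n) (Fin n) ℝ}

theorem add_mem_Ioo_of_mem {θ : ℝ} (hθ : θ ∈ Ioo (-h) 0) : h + θ ∈ Ioo 0 h :=
  ⟨by linarith [hθ.1], by linarith [hθ.2]⟩

namespace IsC2Extension

theorem isSplitKernel_apply {E : Type*} [NormedAddCommGroup E] (hV : IsC2Extension h U V V₁ V₂)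
    (hU : IsDelayLyapunovMatrix h A₀ A₁ D W U P) {F : ℝ → ℝ → Matrix (Fin n) (Fin n) ℝ → E}
    (hF : Continuous fun p : ℝ × ℝ × Matrix (Fin n) (Fin n) ℝ => F p.1 p.2.1 p.2.2) :
    IsSplitKernel (-h) 0 (fun s r => F s r (U (s - r))) (fun s r => F s r (V (s - r)))
      (fun s r => F s r (V (r - s))ᵀ) :=
  .comp_sub (L₂ := fun r => (V r)ᵀ) (fun _ hr => (hV.eqOn (Ioo_subset_Icc_self hr)).symm)
    (fun _ hr => hV.apply_neg hU (Ioo_subset_Icc_self hr)) hV.continuous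
    hV.continuous.matrix_transpose hF

theorem isSplitKernel_mderiv {E : Type*} [NormedAddCommGroup E] (hV : IsC2Extension h U V V₁ V₂)
    (hU : IsDelayLyapunovMatrix h A₀ A₁ D W U P) {F : ℝ → ℝ → Matrix (Fin n) (Fin n) ℝ → E}
    (hF : Continuous fun p : ℝ × ℝ × Matrix (Fin n) (Fin n) ℝ => F p.1 p.2.1 p.2.2) :
    IsSplitKernel (-h) 0 (fun s r => F s r (mderiv U (s - r))) (fun s r => F s r (V₁ (s - r)))
      (fun s r => F s r (-(V₁ (r - s))ᵀ)) :=
  .comp_sub (L₂ := fun r => -(V₁ r)ᵀ) (fun _ hr => hV.mderiv_eq hr)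
    (fun _ hr => hV.mderiv_neg hU hr) hV.continuous₁ hV.continuous₁.matrix_transpose.neg hF

theorem isSplitKernel_mderiv_mderiv {E : Type*} [NormedAddCommGroup E]
    (hV : IsC2Extension h U V V₁ V₂) (hU : IsDelayLyapunovMatrix h A₀ A₁ D W U P)
    {F : ℝ → ℝ → Matrix (Fin n) (Fin n) ℝ → E}
    (hF : Continuous fun p : ℝ × ℝ × Matrix (Fin n) (Fin n) ℝ => F p.1 p.2.1 p.2.2) :
    IsSplitKernel (-h) 0 (fun s r => F s r (mderiv (mderiv U) (s - r)))
      (fun s r => F s r (V₂ (s - r))) (fun s r => F s r (V₂ (r - s))ᵀ) :=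
  .comp_sub (L₂ := fun r => (V₂ r)ᵀ) (fun _ hr => hV.mderiv_mderiv_eq hr)
    (fun _ hr => hV.mderiv_mderiv_neg hU hr) hV.continuous₂ hV.continuous₂.matrix_transpose hF

end IsC2Extension

/-- The Lyapunov-Krasovskii functional term by term as in the definition of `functional`, but with
`U`, `U'` and `U''` replaced by `V`, `V₁` and `V₂`. -/
def expandedFunctional (h : ℝ) (A₁ D P : Matrix (Fin n) (Fin n) ℝ)
    (V V₁ V₂ : ℝ → Matrix (Fin n) (Fin n) ℝ) (ξ : Fin n → ℝ) (φ : ℝ → Fin n → ℝ) : ℝ :=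
  ξ ⬝ᵥ V 0 *ᵥ ξ
  + 2 * (∫ θ in (-h)..0, ξ ⬝ᵥ ((V (h + θ))ᵀ * A₁) *ᵥ φ θ)
  - 2 * (∫ θ in (-h)..0, ξ ⬝ᵥ ((V₁ (h + θ))ᵀ * D) *ᵥ φ θ)
  + triInt (-h) 0 (fun a b => φ a ⬝ᵥ (A₁ᵀ * V (a - b) * A₁) *ᵥ φ b)
      (fun a b => φ a ⬝ᵥ (A₁ᵀ * (V (b - a))ᵀ * A₁) *ᵥ φ b)
  + 2 * triInt (-h) 0 (fun a b => φ a ⬝ᵥ (A₁ᵀ * V₁ (a - b) * D) *ᵥ φ b)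
      (fun a b => φ a ⬝ᵥ (A₁ᵀ * -(V₁ (b - a))ᵀ * D) *ᵥ φ b)
  - triInt (-h) 0 (fun a b => φ a ⬝ᵥ (Dᵀ * V₂ (a - b) * D) *ᵥ φ b)
      (fun a b => φ a ⬝ᵥ (Dᵀ * (V₂ (b - a))ᵀ * D) *ᵥ φ b)
  - ∫ θ in (-h)..0, φ θ ⬝ᵥ (Dᵀ * P * D) *ᵥ φ θ

theorem dotProduct_integral_transpose_mulVec {K L : ℝ → Matrix (Fin n) (Fin n) ℝ} (hh : 0 ≤ h)
    (hKL : EqOn K L (Ioo 0 h)) (hL : Continuous L) (A : Matrix (Fin n) (Fin n) ℝ) (ξ : Fin n → ℝ)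
    {φ : ℝ → Fin n → ℝ} (hφ : Continuous φ) :
    ξ ⬝ᵥ (∫ θ in (-h)..0, ((K (h + θ))ᵀ * A) *ᵥ φ θ) =
      ∫ θ in (-h)..0, ξ ⬝ᵥ ((L (h + θ))ᵀ * A) *ᵥ φ θ := by
  have hcont : Continuous fun θ => ((L (h + θ))ᵀ * A) *ᵥ φ θ := by fun_prop
  rw [← dotProduct_integral ξ (hcont.intervalIntegrable _ _)]
  congr 1
  refine intervalIntegral.integral_congr_Ioo_of_le (neg_nonpos.2 hh) fun θ hθ => ?_
  simp only [hKL (add_mem_Ioo_of_mem hθ)]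

theorem continuous_dotProduct_sandwich_mulVec {φ : ℝ → Fin n → ℝ} (hφ : Continuous φ)
    (A B : Matrix (Fin n) (Fin n) ℝ) :
    Continuous fun p : ℝ × ℝ × Matrix (Fin n) (Fin n) ℝ =>
      φ p.1 ⬝ᵥ (A * p.2.2 * B) *ᵥ φ p.2.1 := by
  fun_prop

theorem IsC2Extension.functional_eq_expandedFunctional (hV : IsC2Extension h U V V₁ V₂)
    (hU : IsDelayLyapunovMatrix h A₀ A₁ D W U P) (hh : 0 ≤ h) (ξ : Fin n → ℝ)
    {φ : ℝ → Fin n → ℝ} (hφ : Continuous φ) :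
    functional h A₁ D U P ξ φ = expandedFunctional h A₁ D P V V₁ V₂ ξ φ := by
  have hneg : -h ≤ 0 := neg_nonpos.2 hh
  have hmixed := dotProduct_integral_transpose_mulVec hh
    (fun r hr => (hV.eqOn (Ioo_subset_Icc_self hr)).symm) hV.continuous A₁ ξ hφ
  have hmixed' := dotProduct_integral_transpose_mulVec hh (fun r hr => hV.mderiv_eq hr)
    hV.continuous₁ D ξ hφ
  have hdouble := (hV.isSplitKernel_apply hU
    (F := fun s r M => φ s ⬝ᵥ (A₁ᵀ * M * A₁) *ᵥ φ r)
    (continuous_dotProduct_sandwich_mulVec hφ A₁ᵀ A₁)).integral_square hneg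
  have hdouble' := (hV.isSplitKernel_mderiv hU
    (F := fun s r M => φ s ⬝ᵥ (A₁ᵀ * M * D) *ᵥ φ r)
    (continuous_dotProduct_sandwich_mulVec hφ A₁ᵀ D)).integral_square hneg
  have hdouble'' := (hV.isSplitKernel_mderiv_mderiv hU
    (F := fun s r M => φ s ⬝ᵥ (Dᵀ * M * D) *ᵥ φ r)
    (continuous_dotProduct_sandwich_mulVec hφ Dᵀ D)).integral_triangles hneg
  unfold functional expandedFunctional
  rw [← hV.eqOn (left_mem_Icc.2 hh), hmixed, hmixed', hdouble, hdouble', ← hdouble'']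
  ring

theorem integral_mixedKernel (hV : Continuous V) (hV₁ : Continuous V₁)
    (A₁ D : Matrix (Fin n) (Fin n) ℝ) (ξ : Fin n → ℝ) {φ : ℝ → Fin n → ℝ} (hφ : Continuous φ) :
    (∫ θ in (-h)..0, ξ ⬝ᵥ mixedKernel A₁ D V V₁ (h + θ) *ᵥ φ θ) =
      (∫ θ in (-h)..0, ξ ⬝ᵥ ((V (h + θ))ᵀ * A₁) *ᵥ φ θ) -
        ∫ θ in (-h)..0, ξ ⬝ᵥ ((V₁ (h + θ))ᵀ * D) *ᵥ φ θ := by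
  rw [← intervalIntegral.integral_sub (Continuous.intervalIntegrable (by fun_prop) _ _)
    (Continuous.intervalIntegrable (by fun_prop) _ _)]
  simp only [mixedKernel, sub_mulVec, dotProduct_sub]

theorem triInt_lowerKernel_upperKernel (hV : Continuous V) (hV₁ : Continuous V₁)
    (hV₂ : Continuous V₂) (A₁ D : Matrix (Fin n) (Fin n) ℝ) {φ : ℝ → Fin n → ℝ}
    (hφ : Continuous φ) (a c : ℝ) :
    triInt a c (fun a b => φ a ⬝ᵥ lowerKernel A₁ D V V₁ V₂ (a - b) *ᵥ φ b)
      (fun a b => φ a ⬝ᵥ upperKernel A₁ D V V₁ V₂ (b - a) *ᵥ φ b) =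
      triInt a c (fun a b => φ a ⬝ᵥ (A₁ᵀ * V (a - b) * A₁) *ᵥ φ b)
        (fun a b => φ a ⬝ᵥ (A₁ᵀ * (V (b - a))ᵀ * A₁) *ᵥ φ b)
      + 2 * triInt a c (fun a b => φ a ⬝ᵥ (A₁ᵀ * V₁ (a - b) * D) *ᵥ φ b)
        (fun a b => φ a ⬝ᵥ (A₁ᵀ * -(V₁ (b - a))ᵀ * D) *ᵥ φ b)
      - triInt a c (fun a b => φ a ⬝ᵥ (Dᵀ * V₂ (a - b) * D) *ᵥ φ b)
        (fun a b => φ a ⬝ᵥ (Dᵀ * (V₂ (b - a))ᵀ * D) *ᵥ φ b) := by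
  rw [← smul_eq_mul 2, ← triInt_smul, ← triInt_add, ← triInt_sub]
  · simp only [lowerKernel, upperKernel, sub_mulVec, add_mulVec, smul_mulVec, dotProduct_sub,
      dotProduct_add, dotProduct_smul, Matrix.mul_neg, Matrix.neg_mul, neg_mulVec, dotProduct_neg,
      smul_neg, ← sub_eq_add_neg]
  all_goals
    simp only [Function.uncurry_def]
    fun_prop

theorem expandedFunctional_eq_lyapunovFunctional (hV : Continuous V) (hV₁ : Continuous V₁)
    (hV₂ : Continuous V₂) (ξ : Fin n → ℝ) {φ : ℝ → Fin n → ℝ} (hφ : Continuous φ) :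
    expandedFunctional h A₁ D P V V₁ V₂ ξ φ = lyapunovFunctional A₁ D V V₁ V₂ h P ξ φ := by
  rw [lyapunovFunctional, kernelFunctional, integral_mixedKernel hV hV₁ A₁ D ξ hφ,
    triInt_lowerKernel_upperKernel hV hV₁ hV₂ A₁ D hφ, expandedFunctional]
  ring

theorem continuous_thetaT (n N : ℕ) : Continuous (thetaT n N) :=
  continuous_matrix fun i q => by
    simp only [thetaT, of_apply]
    fun_prop

theorem continuous_theta (n N : ℕ) : Continuous (theta n N) :=
  (continuous_thetaT n N).matrix_transpose

theorem continuous_theta_sandwich (A B : Matrix (Fin n) (Fin n) ℝ) (q r : Fin N × Fin n) :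
    Continuous fun p : ℝ × ℝ × Matrix (Fin n) (Fin n) ℝ =>
      (theta n N p.1 * (A * p.2.2 * B) * thetaT n N p.2.1) q r := by
  have := continuous_theta n N
  have := continuous_thetaT n N
  exact Continuous.matrix_elem (by fun_prop) q r

/-- The matrix `∫∫ Θ_N(s) A K(s - r) B Θ_N(r)ᵀ dr ds` over the square `[-h, 0]²`, where the kernel
`K(s - r)` is `L₁(s - r)` below the diagonal and `L₂(r - s)` above it. The matrices `J₃`, `J₄` and
`J₅` are of this form. -/
def triMatrix (N : ℕ) (h : ℝ) (A B : Matrix (Fin n) (Fin n) ℝ)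
    (L₁ L₂ : ℝ → Matrix (Fin n) (Fin n) ℝ) : Matrix (Fin N × Fin n) (Fin N × Fin n) ℝ :=
  Matrix.of fun q r => triInt (-h) 0
    (fun a b => (theta n N a * (A * L₁ (a - b) * B) * thetaT n N b) q r)
    (fun a b => (theta n N a * (A * L₂ (b - a) * B) * thetaT n N b) q r)

namespace IsC2Extension

theorem J3_eq_triMatrix (hV : IsC2Extension h U V V₁ V₂)
    (hU : IsDelayLyapunovMatrix h A₀ A₁ D W U P) (hh : 0 ≤ h) :
    J3 N h A₁ U = triMatrix N h A₁ᵀ A₁ V fun r => (V r)ᵀ :=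
  Matrix.ext fun q r => (hV.isSplitKernel_apply hU
    (F := fun a b M => (theta n N a * (A₁ᵀ * M * A₁) * thetaT n N b) q r)
    (continuous_theta_sandwich A₁ᵀ A₁ q r)).integral_square (neg_nonpos.2 hh)

theorem J4_eq_triMatrix (hV : IsC2Extension h U V V₁ V₂)
    (hU : IsDelayLyapunovMatrix h A₀ A₁ D W U P) (hh : 0 ≤ h) :
    J4 N h A₁ D U = triMatrix N h A₁ᵀ D V₁ fun r => -(V₁ r)ᵀ :=
  Matrix.ext fun q r => (hV.isSplitKernel_mderiv hU
    (F := fun a b M => (theta n N a * (A₁ᵀ * M * D) * thetaT n N b) q r)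
    (continuous_theta_sandwich A₁ᵀ D q r)).integral_square (neg_nonpos.2 hh)

theorem J5_eq_triMatrix (hV : IsC2Extension h U V V₁ V₂)
    (hU : IsDelayLyapunovMatrix h A₀ A₁ D W U P) (hh : 0 ≤ h) :
    J5 N h D U = triMatrix N h Dᵀ D V₂ fun r => (V₂ r)ᵀ :=
  Matrix.ext fun q r => (hV.isSplitKernel_mderiv_mderiv hU
    (F := fun a b M => (theta n N a * (Dᵀ * M * D) * thetaT n N b) q r)
    (continuous_theta_sandwich Dᵀ D q r)).triInt_self (neg_nonpos.2 hh)

end IsC2Extension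

theorem continuous_triMatrix_lower {L : ℝ → Matrix (Fin n) (Fin n) ℝ} (hL : Continuous L) (N : ℕ)
    (A B : Matrix (Fin n) (Fin n) ℝ) : Continuous (Function.uncurry fun a b =>
      theta n N a * (A * L (a - b) * B) * thetaT n N b) := by
  have := continuous_theta n N
  have := continuous_thetaT n N
  simp only [Function.uncurry_def]
  fun_prop

theorem continuous_triMatrix_upper {L : ℝ → Matrix (Fin n) (Fin n) ℝ} (hL : Continuous L) (N : ℕ)
    (A B : Matrix (Fin n) (Fin n) ℝ) : Continuous (Function.uncurry fun a b =>
      theta n N a * (A * L (b - a) * B) * thetaT n N b) := by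
  have := continuous_theta n N
  have := continuous_thetaT n N
  simp only [Function.uncurry_def]
  fun_prop

theorem theta_sandwich_apply_swap (A M : Matrix (Fin n) (Fin n) ℝ) (a b : ℝ)
    (q r : Fin N × Fin n) :
    (theta n N b * (Aᵀ * M * A) * thetaT n N a) r q =
      (theta n N a * (Aᵀ * Mᵀ * A) * thetaT n N b) q r := by
  rw [← transpose_apply (theta n N b * (Aᵀ * M * A) * thetaT n N a)]
  simp only [theta, transpose_mul, transpose_transpose, Matrix.mul_assoc]

theorem triMatrix_transpose {L : ℝ → Matrix (Fin n) (Fin n) ℝ} (hL : Continuous L) (N : ℕ) (h : ℝ)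
    (A : Matrix (Fin n) (Fin n) ℝ) :
    (triMatrix N h Aᵀ A L fun r => (L r)ᵀ)ᵀ = triMatrix N h Aᵀ A L fun r => (L r)ᵀ := by
  ext q r
  refine (triInt_swap
    (k₁ := fun a b => (theta n N a * (Aᵀ * L (a - b) * A) * thetaT n N b) r q)
    (k₂ := fun a b => (theta n N a * (Aᵀ * (L (b - a))ᵀ * A) * thetaT n N b) r q)
    ((continuous_triMatrix_lower hL N Aᵀ A).matrix_elem r q)
    ((continuous_triMatrix_upper hL.matrix_transpose N Aᵀ A).matrix_elem r q) (-h) 0).trans ?_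
  rw [triMatrix, of_apply]
  congr 1 <;> funext a b <;> rw [theta_sandwich_apply_swap A _ a b q r]
  rw [transpose_transpose]

theorem J6_transpose (N : ℕ) (h : ℝ) (D : Matrix (Fin n) (Fin n) ℝ) (hP : Pᵀ = P) :
    (J6 N h D P)ᵀ = J6 N h D P := by
  ext q r
  simp only [J6, transpose_apply, of_apply, theta_sandwich_apply_swap D P _ _ q r, hP]

theorem dotProduct_triMatrix_mulVec {L₁ L₂ : ℝ → Matrix (Fin n) (Fin n) ℝ} (h₁ : Continuous L₁)
    (h₂ : Continuous L₂) (h : ℝ) (A B : Matrix (Fin n) (Fin n) ℝ) (Φ : Fin N × Fin n → ℝ) :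
    Φ ⬝ᵥ triMatrix N h A B L₁ L₂ *ᵥ Φ =
      triInt (-h) 0
        (fun a b => (thetaT n N a *ᵥ Φ) ⬝ᵥ (A * L₁ (a - b) * B) *ᵥ (thetaT n N b *ᵥ Φ))
        (fun a b => (thetaT n N a *ᵥ Φ) ⬝ᵥ (A * L₂ (b - a) * B) *ᵥ (thetaT n N b *ᵥ Φ)) := by
  refine (dotProduct_triInt_mulVec (continuous_triMatrix_lower h₁ N A B)
    (continuous_triMatrix_upper h₂ N A B) Φ Φ (-h) 0).trans ?_
  simp only [mulVec_dotProduct_mulVec, mulVec_mulVec, theta, Matrix.mul_assoc]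

theorem dotProduct_mixedMatrix_mulVec {K L : ℝ → Matrix (Fin n) (Fin n) ℝ} (hh : 0 ≤ h)
    (hKL : EqOn K L (Ioo 0 h)) (hL : Continuous L) (A : Matrix (Fin n) (Fin n) ℝ)
    (ξ : Fin n → ℝ) (Φ : Fin N × Fin n → ℝ) :
    ξ ⬝ᵥ (Matrix.of fun i q => ∫ θ in (-h)..0, ((K (h + θ))ᵀ * A * thetaT n N θ) i q) *ᵥ Φ =
      ∫ θ in (-h)..0, ξ ⬝ᵥ ((L (h + θ))ᵀ * A) *ᵥ (thetaT n N θ *ᵥ Φ) := by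
  have hKL_int : (Matrix.of fun i q => ∫ θ in (-h)..0, ((K (h + θ))ᵀ * A * thetaT n N θ) i q) =
      Matrix.of fun i q => ∫ θ in (-h)..0, ((L (h + θ))ᵀ * A * thetaT n N θ) i q := by
    ext i q
    refine intervalIntegral.integral_congr_Ioo_of_le (neg_nonpos.2 hh) fun θ hθ => ?_
    simp only [hKL (add_mem_Ioo_of_mem hθ)]
  have := continuous_thetaT n N
  have hcont : Continuous fun θ => (L (h + θ))ᵀ * A * thetaT n N θ := by fun_prop
  rw [hKL_int, dotProduct_integral_mulVec hcont]
  simp only [mulVec_mulVec]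

theorem dotProduct_J6_mulVec (h : ℝ) (D P : Matrix (Fin n) (Fin n) ℝ) (Φ : Fin N × Fin n → ℝ) :
    Φ ⬝ᵥ J6 N h D P *ᵥ Φ =
      ∫ θ in (-h)..0, (thetaT n N θ *ᵥ Φ) ⬝ᵥ (Dᵀ * P * D) *ᵥ (thetaT n N θ *ᵥ Φ) := by
  have := continuous_theta n N
  have := continuous_thetaT n N
  have hcont : Continuous fun θ => theta n N θ * (Dᵀ * P * D) * thetaT n N θ := by fun_prop
  rw [J6, dotProduct_integral_mulVec hcont]
  simp only [mulVec_dotProduct_mulVec, mulVec_mulVec, theta, Matrix.mul_assoc]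

theorem dotProduct_PMat_mulVec (N : ℕ) (h : ℝ) (A₁ D : Matrix (Fin n) (Fin n) ℝ)
    (U : ℝ → Matrix (Fin n) (Fin n) ℝ) (P : Matrix (Fin n) (Fin n) ℝ) (ξ : Fin n → ℝ)
    (Φ : Fin N × Fin n → ℝ) :
    Xi ξ Φ ⬝ᵥ PMat N h A₁ D U P *ᵥ Xi ξ Φ =
      ξ ⬝ᵥ U 0 *ᵥ ξ + 2 * (ξ ⬝ᵥ J1 N h A₁ U *ᵥ Φ) - 2 * (ξ ⬝ᵥ J2 N h D U *ᵥ Φ)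
        + Φ ⬝ᵥ J3 N h A₁ U *ᵥ Φ + 2 * (Φ ⬝ᵥ J4 N h A₁ D U *ᵥ Φ) - Φ ⬝ᵥ J5 N h D U *ᵥ Φ
        - Φ ⬝ᵥ J6 N h D P *ᵥ Φ := by
  simp only [Xi, PMat, fromBlocks_mulVec, Sum.elim_comp_inl, Sum.elim_comp_inr,
    sumElim_dotProduct_sumElim, dotProduct_add, sub_mulVec, add_mulVec, dotProduct_sub,
    transpose_sub, dotProduct_transpose_mulVec]
  ring

theorem contDiff_thetaT_mulVec (Φ : Fin N × Fin n → ℝ) :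
    ContDiff ℝ 1 fun θ => thetaT n N θ *ᵥ Φ := by
  refine contDiff_pi.2 fun i => ?_
  simp only [mulVec, dotProduct, thetaT, of_apply]
  fun_prop

namespace IsC2Extension

theorem dotProduct_PMat_mulVec_eq_expandedFunctional (hV : IsC2Extension h U V V₁ V₂)
    (hU : IsDelayLyapunovMatrix h A₀ A₁ D W U P) (hh : 0 ≤ h) (ξ : Fin n → ℝ)
    (Φ : Fin N × Fin n → ℝ) :
    Xi ξ Φ ⬝ᵥ PMat N h A₁ D U P *ᵥ Xi ξ Φ =
      expandedFunctional h A₁ D P V V₁ V₂ ξ fun θ => thetaT n N θ *ᵥ Φ := by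
  have hV' := hV.continuous.matrix_transpose
  have hV₁' : Continuous fun r => -(V₁ r)ᵀ := hV.continuous₁.matrix_transpose.neg
  have hV₂' := hV.continuous₂.matrix_transpose
  rw [dotProduct_PMat_mulVec, expandedFunctional, hV.J3_eq_triMatrix hU hh,
    hV.J4_eq_triMatrix hU hh, hV.J5_eq_triMatrix hU hh,
    dotProduct_triMatrix_mulVec hV.continuous hV', dotProduct_triMatrix_mulVec hV.continuous₁ hV₁',
    dotProduct_triMatrix_mulVec hV.continuous₂ hV₂', dotProduct_J6_mulVec, J1, J2,
    dotProduct_mixedMatrix_mulVec hh (fun r hr => (hV.eqOn (Ioo_subset_Icc_self hr)).symm)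
      hV.continuous,
    dotProduct_mixedMatrix_mulVec hh (fun r hr => hV.mderiv_eq hr) hV.continuous₁,
    hV.eqOn (left_mem_Icc.2 hh)]

theorem functional_thetaT_mulVec (hV : IsC2Extension h U V V₁ V₂)
    (hU : IsDelayLyapunovMatrix h A₀ A₁ D W U P) (hh : 0 ≤ h) (ξ : Fin n → ℝ)
    (Φ : Fin N × Fin n → ℝ) :
    functional h A₁ D U P ξ (fun θ => thetaT n N θ *ᵥ Φ) =
      Xi ξ Φ ⬝ᵥ PMat N h A₁ D U P *ᵥ Xi ξ Φ :=
  (hV.functional_eq_expandedFunctional hU hh ξ (contDiff_thetaT_mulVec Φ).continuous).trans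
    (hV.dotProduct_PMat_mulVec_eq_expandedFunctional hU hh ξ Φ).symm

theorem PMat_isHermitian (hV : IsC2Extension h U V V₁ V₂)
    (hU : IsDelayLyapunovMatrix h A₀ A₁ D W U P) (hh : 0 < h) (N : ℕ) :
    (PMat N h A₁ D U P).IsHermitian := by
  have hP : Pᵀ = P := by
    rw [← hV.deriv_zero_add_transpose hU hh, transpose_add, transpose_transpose, add_comm]
  have hU₀ : (U 0)ᵀ = U 0 := by
    rw [← hV.eqOn (left_mem_Icc.2 hh.le), hV.transpose_apply_zero hU hh.le]
  have hJ₃ : (J3 N h A₁ U)ᵀ = J3 N h A₁ U := by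
    rw [hV.J3_eq_triMatrix hU hh.le, triMatrix_transpose hV.continuous]
  have hJ₅ : (J5 N h D U)ᵀ = J5 N h D U := by
    rw [hV.J5_eq_triMatrix hU hh.le, triMatrix_transpose hV.continuous₂]
  rw [PMat, isHermitian_fromBlocks_iff]
  refine ⟨hU₀, conjTranspose_eq_transpose_of_trivial _, transpose_transpose _, ?_⟩
  rw [IsHermitian, conjTranspose_eq_transpose_of_trivial]
  simp only [transpose_sub, transpose_add, transpose_transpose, hJ₃, hJ₅, J6_transpose N h D hP]
  abel

theorem PMat_posSemidef (hV : IsC2Extension h U V V₁ V₂)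
    (hU : IsDelayLyapunovMatrix h A₀ A₁ D W U P) (hh : 0 < h) (hW : W.PosSemidef)
    (hs : ExpStable h A₀ A₁ D) (N : ℕ) : (PMat N h A₁ D U P).PosSemidef := by
  refine .of_dotProduct_mulVec_nonneg (hV.PMat_isHermitian hU hh N) fun v => ?_
  have hv : v = Xi (v ∘ Sum.inl) (v ∘ Sum.inr) := (Sum.elim_comp_inl_inr v).symm
  rw [star_trivial, hv, hV.dotProduct_PMat_mulVec_eq_expandedFunctional hU hh.le,
    expandedFunctional_eq_lyapunovFunctional hV.continuous hV.continuous₁ hV.continuous₂ _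
      (contDiff_thetaT_mulVec _).continuous]
  exact hV.lyapunovFunctional_nonneg hU hh hW hs _ (contDiff_thetaT_mulVec _)

end IsC2Extension

theorem polyApprox_eq_thetaT_mulVec {p : Fin N → Polynomial ℝ}
    (hp : ∀ k, (p k).degree < (N : WithBot ℕ)) (Q : Fin N × Fin n → ℝ) (θ : ℝ) :
    polyApprox p Q θ = thetaT n N θ *ᵥ monomialCoeffs p Q := by
  have heval : ∀ j, (p j).eval θ = ∑ k : Fin N, (p j).coeff k * θ ^ (k : ℕ) := fun j => by
    rw [Polynomial.eval_eq_sum]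
    exact (Polynomial.sum_fin _ (by simp) (hp j)).symm
  ext i
  simp only [polyApprox, polyT, mulVec, dotProduct, thetaT, monomialCoeffs, of_apply, one_apply,
    mul_ite, mul_one, mul_zero, ite_mul, zero_mul, Fintype.sum_prod_type, Finset.sum_ite_eq,
    Finset.mem_univ, if_true]
  simp only [heval, Finset.sum_mul, Finset.mul_sum]
  rw [Finset.sum_comm]
  exact Finset.sum_congr rfl fun k _ => Finset.sum_congr rfl fun j _ => by ring

end QuadraticForm

end

end NeutralDelay

open NeutralDelay in
theorem mainTheorem3_general {n : ℕ} (h : ℝ) (hh : 0 < h) (A₀ A₁ D W : Matrix (Fin n) (Fin n) ℝ)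
    (hW : W.PosSemidef) (U : ℝ → Matrix (Fin n) (Fin n) ℝ) (P : Matrix (Fin n) (Fin n) ℝ)
    (hU : IsDelayLyapunovMatrix h A₀ A₁ D W U P) (hstab : ExpStable h A₀ A₁ D) (N : ℕ) :
    (PMat N h A₁ D U P).PosSemidef ∧
    ∀ p : Fin N → Polynomial ℝ, (∀ k, (p k).degree < (N : WithBot ℕ)) → ∀ Q : Fin N × Fin n → ℝ,
      (∀ θ, polyApprox p Q θ = thetaT n N θ *ᵥ monomialCoeffs p Q) ∧
      ∀ ξ, functional h A₁ D U P ξ (polyApprox p Q) =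
        Xi ξ (monomialCoeffs p Q) ⬝ᵥ PMat N h A₁ D U P *ᵥ Xi ξ (monomialCoeffs p Q) := by
  obtain ⟨V, V₁, V₂, hV⟩ :=
    hU.exists_isC2Extension hh.le (steinMap_injective (hstab.tendsto_pow hh))
  refine ⟨hV.PMat_posSemidef hU hh hW hstab N, fun p hp Q => ?_⟩
  have hpoly := polyApprox_eq_thetaT_mulVec hp Q
  refine ⟨hpoly, fun ξ => ?_⟩
  rw [funext hpoly, hV.functional_thetaT_mulVec hU hh.le]

theorem mainTheorem3 {n : ℕ} (h : ℝ) (hh : 0 < h)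
    (A₀ A₁ D W : Matrix (Fin n) (Fin n) ℝ) (hW : W.PosDef)
    (U : ℝ → Matrix (Fin n) (Fin n) ℝ) (P : Matrix (Fin n) (Fin n) ℝ)
    (hU : NeutralDelay.IsDelayLyapunovMatrix h A₀ A₁ D W U P)
    (hstab : NeutralDelay.ExpStable h A₀ A₁ D) (N : ℕ) :
    (NeutralDelay.PMat N h A₁ D U P).PosSemidef ∧
    ∀ (p : Fin N → Polynomial ℝ), (∀ k, (p k).degree < (N : WithBot ℕ)) →
      ∀ Q : Fin N × Fin n → ℝ,
        (∀ θ : ℝ, NeutralDelay.polyApprox p Q θ =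
          NeutralDelay.thetaT n N θ *ᵥ NeutralDelay.monomialCoeffs p Q) ∧
        (NeutralDelay.v0 h A₁ D U P (NeutralDelay.polyApprox p Q) =
          NeutralDelay.Xi (NeutralDelay.polyApprox p Q 0 - D *ᵥ NeutralDelay.polyApprox p Q (-h))
              (NeutralDelay.monomialCoeffs p Q) ⬝ᵥ
            NeutralDelay.PMat N h A₁ D U P *ᵥ
            NeutralDelay.Xi (NeutralDelay.polyApprox p Q 0 - D *ᵥ NeutralDelay.polyApprox p Q (-h))
              (NeutralDelay.monomialCoeffs p Q)) ∧
        ∀ φ : ℝ → Fin n → ℝ, NeutralDelay.IsPC1On φ (-h) 0 →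
          NeutralDelay.functional h A₁ D U P (φ 0 - D *ᵥ φ (-h)) (NeutralDelay.polyApprox p Q) =
            NeutralDelay.Xi (φ 0 - D *ᵥ φ (-h)) (NeutralDelay.monomialCoeffs p Q) ⬝ᵥ
              NeutralDelay.PMat N h A₁ D U P *ᵥ
              NeutralDelay.Xi (φ 0 - D *ᵥ φ (-h)) (NeutralDelay.monomialCoeffs p Q) := by
  obtain ⟨hpos, hquad⟩ :=
    mainTheorem3_general h hh A₀ A₁ D W hW.posSemidef U P hU hstab N
  exact ⟨hpos, fun p hp Q => ⟨(hquad p hp Q).1, (hquad p hp Q).2 _, fun φ _ => (hquad p hp Q).2 _⟩⟩
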